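/- All graphs are finite and simple. A drawing of a graph represents its vertices by distinct points of the plane and each edge by a simple arc that joins the points of its two ends and contains no other vertex point. As usual, whenever two edges have a common point that is not a vertex, they cross (rather than touch) there, and no three edges have a common point other than a vertex. A crossing is an unordered pair of distinct edges together with a common point of these edges that is not a vertex. The crossing number $\mathrm{cr}(H)$ is the minimum number of crossings over all drawings of $H$. A drawing is good if edges with a common end have no other common point, and no two edges meet more than once. Let $P_n$ be the path with $n$ edges and let $G$ be a graph. The Cartesian product $G\Box P_n$ consists of copies $G^0,\dots,G^n$ of $G$ and of the path edges; those joining $G^i$ to $G^{i+1}$ form the subgraph $H^i$ ($0\le i\le n-1$). For a positive integer $a$, a good drawing of $G\Box P_n$ is $a$-restricted if, for each $i$, fewer than $a$ of its crossings involve at least one edge of $G^i$. For subgraphs $X,Y$ let $X\otimes Y$ be the set of unordered pairs of an edge of $X$ and an edge of $Y$. For $0\le i\le d$ the crossing band $A^d_i$ of $G\Box P_d$ is $$A^d_i=\bigcup_{j=0}^{2i}\Big((G^j\cup H^j)\otimes(G^{2i-j-1}\cup H^{2i-j-1}\cup G^{2i-j})\Big)\cup\Big(H^j\otimes H^{2i-j-2}\Big),$$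 where $G^k$ is empty unless $0\le k\le d$ and $H^k$ is empty unless $0\le k\le d-1$. Let $d\ge 2$, $0<m<d$ and $a\ge 1$ be integers. Let $F$, $M$ and $E$ be the minimum numbers of crossings between pairs of edges in $A^d_0\cup\dots\cup A^d_{m-1}$, in $A^d_m$, and in $A^d_{m+1}\cup\dots\cup A^d_d$, respectively, each minimum being taken separately over all $a$-restricted good drawings of $G\Box P_d$ (and being $+\infty$ if there is no such drawing). Theorem. Let $b$ be an integer. If $$\mathrm{cr}(G\Box P_{d-1})\ge a(d-1)-b,\qquad F+E\ge a(d-1)-b\qquad\text{and}\qquad M\ge a,$$ then $\mathrm{cr}(G\Box P_n)\ge an-b$ for all $n\ge d$. -/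

import Mathlib

/-- The Euclidean plane. -/
abbrev Plane : Type := EuclideanSpace ℝ (Fin 2)

/-- `A` and `B` cross (and are not merely tangent) at `x`: in a neighbourhood of `x`, in suitable
continuous coordinates centred at `x`, `A` is the horizontal and `B` the vertical axis. -/
def CrossesAt (A B : Set Plane) (x : Plane) : Prop :=
  ∃ φ : OpenPartialHomeomorph Plane Plane, x ∈ φ.source ∧ φ x = 0 ∧
    ∀ y ∈ φ.source, (y ∈ A ↔ φ y 1 = 0) ∧ (y ∈ B ↔ φ y 0 = 0)

/-- A drawing of the graph `H` in the plane. Vertices are distinct points, and each edge is a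
simple arc joining its two ends and meeting no other vertex. As usual, two edges that meet at a
point that is not a vertex cross there, and no three edges meet at such a point. Two edges may
cross several times, also if they have a common end.

(The values of `arc` at pairs that are not edges are irrelevant.) -/
structure Drawing {W : Type*} (H : SimpleGraph W) where
  point : W → Plane
  arc : Sym2 W → Set Plane
  point_injective : Function.Injective point
  isArc : ∀ u v, H.Adj u v → ∃ γ : Path (point u) (point v),
    Function.Injective γ ∧ Set.range γ = arc s(u, v)
  mem_of_point_mem : ∀ e ∈ H.edgeSet, ∀ w, point w ∈ arc e → w ∈ e
  crossesAt : ∀ e ∈ H.edgeSet, ∀ f ∈ H.edgeSet, e ≠ f →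
    ∀ x ∈ arc e ∩ arc f, x ∉ Set.range point → CrossesAt (arc e) (arc f) x
  no_three : ∀ e ∈ H.edgeSet, ∀ f ∈ H.edgeSet, ∀ g ∈ H.edgeSet, e ≠ f → f ≠ g → e ≠ g →
    arc e ∩ arc f ∩ arc g ⊆ Set.range point

namespace Drawing

variable {W : Type*} {H : SimpleGraph W}

/-- The crossings of a drawing: a crossing is an unordered pair of distinct edges together with a
common point of the two edges that is not a vertex. -/
def crossings (D : Drawing H) : Set (Sym2 (Sym2 W) × Plane) :=
  {c | ∃ e ∈ H.edgeSet, ∃ f ∈ H.edgeSet, e ≠ f ∧ c.1 = s(e, f) ∧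
    c.2 ∈ D.arc e ∩ D.arc f ∧ c.2 ∉ Set.range D.point}

/-- The number of crossings of a drawing. -/
noncomputable def crossingCount (D : Drawing H) : ℕ∞ := D.crossings.encard

/-- The number of crossings of a drawing between pairs of edges that belong to `B`. -/
noncomputable def crossingCountIn (D : Drawing H) (B : Set (Sym2 (Sym2 W))) : ℕ∞ :=
  {c ∈ D.crossings | c.1 ∈ B}.encard

/-- A drawing is good if edges with a common end meet only there, and no two edges meet more
than once. -/
def IsGood (D : Drawing H) : Prop :=
  (∀ e ∈ H.edgeSet, ∀ f ∈ H.edgeSet, e ≠ f → ∀ w, w ∈ e → w ∈ f →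
    D.arc e ∩ D.arc f = {D.point w}) ∧
  (∀ e ∈ H.edgeSet, ∀ f ∈ H.edgeSet, e ≠ f → (D.arc e ∩ D.arc f).Subsingleton)

end Drawing

/-- The crossing number of a graph: the minimum number of crossings over all its drawings. -/
noncomputable def crossingNumber {W : Type*} (H : SimpleGraph W) : ℕ∞ :=
  ⨅ D : Drawing H, D.crossingCount

section PathProduct

variable {V : Type*} (G : SimpleGraph V)

/-- The Cartesian product of `G` with the path `P_n` with `n` edges (and `n + 1` vertices). -/
def pathProduct (n : ℕ) : SimpleGraph (V × Fin (n + 1)) :=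
  G.boxProd (SimpleGraph.pathGraph (n + 1))

/-- The edges of the `k`-th copy `G^k` of `G` in `G □ P_n`; empty unless `0 ≤ k ≤ n`. -/
def copyEdges (n : ℕ) (k : ℤ) : Set (Sym2 (V × Fin (n + 1))) :=
  {e | ∃ u v : V, ∃ i : Fin (n + 1), G.Adj u v ∧ (i : ℤ) = k ∧ e = s((u, i), (v, i))}

/-- The edges of `H^k`, that is, the path edges of `G □ P_n` that link the copies `G^k` and
`G^(k+1)`; empty unless `0 ≤ k ≤ n - 1`. -/
def linkEdges (V : Type*) (n : ℕ) (k : ℤ) : Set (Sym2 (V × Fin (n + 1))) :=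
  {e | ∃ u : V, ∃ i j : Fin (n + 1), (i : ℤ) = k ∧ (j : ℤ) = k + 1 ∧ e = s((u, i), (u, j))}

/-- The unordered pairs consisting of a member of `S` and a member of `T`. -/
def crossPairs {E : Type*} (S T : Set E) : Set (Sym2 E) :=
  {p | ∃ e ∈ S, ∃ f ∈ T, p = s(e, f)}

/-- The crossing band `A^n_i` of `G □ P_n`. -/
def crossingBand (n : ℕ) (i : ℤ) : Set (Sym2 (Sym2 (V × Fin (n + 1)))) :=
  ⋃ j ∈ Set.Icc (0 : ℤ) (2 * i),
    crossPairs (copyEdges G n j ∪ linkEdges V n j)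
      (copyEdges G n (2 * i - j - 1) ∪ linkEdges V n (2 * i - j - 1) ∪
        copyEdges G n (2 * i - j)) ∪
    crossPairs (linkEdges V n j) (linkEdges V n (2 * i - j - 2))

variable {G} in
/-- A drawing of `G □ P_n` is `a`-restricted if it is good and each copy of `G` has fewer than `a`
crossings on its edges. -/
def Drawing.IsRestricted {n : ℕ} (a : ℕ) (D : Drawing (pathProduct G n)) : Prop :=
  D.IsGood ∧ ∀ i : Fin (n + 1),
    D.crossingCountIn (crossPairs (copyEdges G n (i : ℤ)) (pathProduct G n).edgeSet) < a

/-- The minimum number of crossings between pairs of edges in `B` over all `a`-restricted drawings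
of `G □ P_d` (`⊤` if there is no such drawing). -/
noncomputable def restrictedCrossingNumber (a d : ℕ) (B : Set (Sym2 (Sym2 (V × Fin (d + 1))))) :
    ℕ∞ :=
  ⨅ D : {D : Drawing (pathProduct G d) // D.IsRestricted a}, D.1.crossingCountIn B

/-- The front force: crossings in the first `m` bands `A^d_0, …, A^d_(m-1)`. -/
noncomputable def frontForce (d m a : ℕ) : ℕ∞ :=
  restrictedCrossingNumber G a d (⋃ i ∈ Set.Ico (0 : ℤ) m, crossingBand G d i)

/-- The middle force: crossings in the band `A^d_m`. -/
noncomputable def middleForce (d m a : ℕ) : ℕ∞ :=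
  restrictedCrossingNumber G a d (crossingBand G d m)

/-- The end force: crossings in the final `d - m` bands `A^d_(m+1), …, A^d_d`. -/
noncomputable def endForce (d m a : ℕ) : ℕ∞ :=
  restrictedCrossingNumber G a d (⋃ i ∈ Set.Ioc (m : ℤ) d, crossingBand G d i)

end PathProduct

/-- `AtLeast x z` says `x ≥ z`, for an integer `z` and a natural number or infinity `x`. -/
def AtLeast (x : ℕ∞) (z : ℤ) : Prop := ∀ k : ℕ, x = k → z ≤ k

/-! The proof is by induction on `n`, started at `n = d - 1`, where the bound is a hypothesis. An
optimal drawing of `G □ P_(n+1)` with finitely many crossings may be taken to be good, and there are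
two cases.

If the drawing is not `a`-restricted, some copy of `G` carries at least `a` crossings. Deleting its
edges and merging the two path edges at each of its vertices (for an end copy, deleting the pendant
path edges) gives a drawing of `G □ P_n` that lacks these crossings, and induction applies
(`exists_delete_copy`).

If it is `a`-restricted, so is its restriction to each translate of `G □ P_d`. The front bands of
the first translate, the middle bands of all translates and the end bands of the last one are
pairwise disjoint sets of edge pairs. To see this, give a pair of edges the sum of the path
coordinates of its four ends as level: band `i` lives on the levels from `4i - 2` to `4i + 1`, and
translation by `k` adds `4k`. Hence the crossings number at least `F + E` plus `a` per translate
(`force_le`).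

The topological part is that optimal drawings are good. If two edges have two common points, these
can be chosen consecutive on one of the edges. The segments between them are interchanged, and the
corners that arise are cut at the points that are not vertices. No crossing point is created and at
least one disappears (`exists_isSwap`, `exists_crossingPoints_ssubset`). -/

/-- `S` is a (possibly degenerate) simple arc from `x` to `y`. -/
def IsArcBetween {X : Type*} [TopologicalSpace X] (x y : X) (S : Set X) : Prop :=
  ∃ (γ : ℝ → X) (s t : ℝ), s ≤ t ∧ ContinuousOn γ (Set.Icc s t) ∧ Set.InjOn γ (Set.Icc s t) ∧
    γ s = x ∧ γ t = y ∧ γ '' Set.Icc s t = S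

/-! ### Simple arcs: cutting, joining and comparing them locally. -/

namespace IsArcBetween

open Set Filter Topology

section

variable {X : Type*} [TopologicalSpace X] {x y z : X} {S T : Set X}

theorem left_mem (h : IsArcBetween x y S) : x ∈ S := by
  obtain ⟨γ, s, t, hst, -, -, rfl, -, rfl⟩ := h
  exact mem_image_of_mem _ (left_mem_Icc.2 hst)

theorem right_mem (h : IsArcBetween x y S) : y ∈ S := by
  obtain ⟨γ, s, t, hst, -, -, -, rfl, rfl⟩ := h
  exact mem_image_of_mem _ (right_mem_Icc.2 hst)

theorem isCompact (h : IsArcBetween x y S) : IsCompact S := by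
  obtain ⟨γ, s, t, hst, hc, -, -, -, rfl⟩ := h
  exact isCompact_Icc.image_of_continuousOn hc

theorem isClosed [T2Space X] (h : IsArcBetween x y S) : IsClosed S :=
  h.isCompact.isClosed

theorem subarc {γ : ℝ → X} {s t a b : ℝ} (hc : ContinuousOn γ (Icc s t))
    (hi : InjOn γ (Icc s t)) (hsa : s ≤ a) (hab : a ≤ b) (hbt : b ≤ t) :
    IsArcBetween (γ a) (γ b) (γ '' Icc a b) :=
  ⟨γ, a, b, hab, hc.mono (Icc_subset_Icc hsa hbt), hi.mono (Icc_subset_Icc hsa hbt), rfl, rfl, rfl⟩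

theorem symm (h : IsArcBetween x y S) : IsArcBetween y x S := by
  obtain ⟨γ, s, t, hst, hc, hi, rfl, rfl, rfl⟩ := h
  refine ⟨fun r => γ (-r), -t, -s, by linarith, ?_, ?_, by simp, by simp, ?_⟩
  · exact hc.comp (by fun_prop) (fun r hr => ⟨by linarith [hr.2], by linarith [hr.1]⟩)
  · intro a ha b hb hab
    have := @hi (-a) ⟨by linarith [ha.2], by linarith [ha.1]⟩ (-b)
      ⟨by linarith [hb.2], by linarith [hb.1]⟩ hab
    linarith
  · have : (fun r => γ (-r)) '' Icc (-t) (-s) = γ '' ((fun r => -r) '' Icc (-t) (-s)) := by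
      rw [image_image]
    rw [this]; simp

theorem concat (h : IsArcBetween x y S) (h' : IsArcBetween y z T) (hST : S ∩ T ⊆ {y}) :
    IsArcBetween x z (S ∪ T) := by
  obtain ⟨γ, s, t, hst, hc, hi, rfl, rfl, rfl⟩ := h
  obtain ⟨δ, a, b, hab, hc', hi', hy, rfl, rfl⟩ := h'
  set f : ℝ → X := fun r => if r ≤ t then γ r else δ (r - t + a) with hf
  have f1 : ∀ r ∈ Icc s t, f r = γ r := fun r hr => by simp [hf, hr.2]
  have f2 : ∀ r ∈ Icc t (t + (b - a)), f r = δ (r - t + a) := by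
    intro r hr
    rcases hr.1.eq_or_lt with rfl | h
    · simp [hf, hy]
    · simp [hf, h]
  have m2 : ∀ r ∈ Icc t (t + (b - a)), r - t + a ∈ Icc a b := fun r hr =>
    ⟨by linarith [hr.1], by linarith [hr.2]⟩
  have hU : Icc s (t + (b - a)) = Icc s t ∪ Icc t (t + (b - a)) :=
    (Icc_union_Icc_eq_Icc hst (by linarith)).symm
  have c1 : ContinuousOn f (Icc s t) := hc.congr f1
  have c2 : ContinuousOn f (Icc t (t + (b - a))) := by
    refine ContinuousOn.congr ?_ f2
    exact hc'.comp (by fun_prop) m2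
  have key : ∀ p ∈ Icc s t, ∀ q ∈ Icc t (t + (b - a)), f p = f q → p = q := by
    intro p hp q hq h
    have e1 := f1 p hp
    have e2 := f2 q hq
    have hm : γ p ∈ γ '' Icc s t ∩ δ '' Icc a b :=
      ⟨mem_image_of_mem _ hp, ⟨_, m2 q hq, by rw [← e2, ← h, e1]⟩⟩
    have h1 : γ p = γ t := hST hm
    have h2 : p = t := hi hp ⟨hst, le_rfl⟩ h1
    have h3 : δ (q - t + a) = δ a := by rw [← e2, ← h, e1, h1, hy]
    have h4 := hi' (m2 q hq) ⟨le_rfl, hab⟩ h3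
    linarith
  refine ⟨f, s, t + (b - a), by linarith, ?_, ?_, f1 _ ⟨le_rfl, hst⟩, ?_, ?_⟩
  · rw [hU]
    exact c1.union_of_isClosed c2 isClosed_Icc isClosed_Icc
  · rw [hU]
    rintro p (hp | hp) q (hq | hq) h
    · exact hi hp hq (by rw [← f1 p hp, ← f1 q hq, h])
    · exact key p hp q hq h
    · exact (key q hq p hp h.symm).symm
    · have := hi' (m2 p hp) (m2 q hq) (by rw [← f2 p hp, ← f2 q hq, h])
      linarith
  · rw [f2 _ ⟨by linarith, le_rfl⟩]; congr 1; ring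
  · rw [hU, image_union, image_congr f1, image_congr f2]
    congr 1
    ext w; constructor
    · rintro ⟨r, hr, rfl⟩; exact ⟨_, m2 r hr, rfl⟩
    · rintro ⟨r, hr, rfl⟩
      exact ⟨r - a + t, ⟨by linarith [hr.1], by linarith [hr.2]⟩, congrArg δ (by ring)⟩

theorem split (h : IsArcBetween x y S) (hz : z ∈ S) :
    ∃ S₁ S₂, IsArcBetween x z S₁ ∧ IsArcBetween z y S₂ ∧ S₁ ∪ S₂ = S ∧ S₁ ∩ S₂ ⊆ {z} := by
  obtain ⟨γ, s, t, hst, hc, hi, rfl, rfl, rfl⟩ := h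
  obtain ⟨r, hr, rfl⟩ := hz
  refine ⟨_, _, subarc hc hi le_rfl hr.1 hr.2, subarc hc hi hr.1 hr.2 le_rfl, ?_, ?_⟩
  · rw [← image_union, Icc_union_Icc_eq_Icc hr.1 hr.2]
  · rintro _ ⟨⟨p, hp, rfl⟩, q, hq, h⟩
    have := hi ⟨hr.1.trans hq.1, hq.2⟩ ⟨hp.1, hp.2.trans hr.2⟩ h
    have : p = r := le_antisymm hp.2 (this ▸ hq.1)
    simp [this]

/-- The union of two arcs with a common end contains an arc joining the other two ends. -/
theorem exists_subset_union [T2Space X] (h : IsArcBetween x y S) (h' : IsArcBetween y z T) :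
    ∃ U ⊆ S ∪ T, IsArcBetween x z U := by
  obtain ⟨γ, s, t, hst, hc, hi, rfl, rfl, rfl⟩ := h
  have hcl : IsCompact (Icc s t ∩ γ ⁻¹' T) :=
    isCompact_Icc.of_isClosed_subset (hc.preimage_isClosed_of_isClosed isClosed_Icc h'.isClosed)
      inter_subset_left
  -- The first arc is followed up to the first point at which it meets `T`, and `T` from there on.
  obtain ⟨r, ⟨hr, hrT⟩, hmin⟩ := hcl.exists_isLeast ⟨t, ⟨hst, le_rfl⟩, h'.left_mem⟩
  obtain ⟨T₁, T₂, -, hT₂, hT, -⟩ := h'.split hrT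
  have hsub : T₂ ⊆ T := hT ▸ subset_union_right
  refine ⟨_, ?_, (subarc hc hi le_rfl hr.1 hr.2).concat hT₂ ?_⟩
  · exact union_subset_union (image_mono (Icc_subset_Icc_right hr.2)) hsub
  · rintro _ ⟨⟨p, hp, rfl⟩, hpT⟩
    have : r ≤ p := hmin ⟨⟨hp.1, hp.2.trans hr.2⟩, hsub hpT⟩
    rw [le_antisymm hp.2 this]; rfl

theorem exists_mem_nhds_ne (h : IsArcBetween x y S) (hxy : x ≠ y) {U : Set X} (hU : U ∈ 𝓝 y) :
    ∃ w ∈ S, w ∈ U ∧ w ≠ y := by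
  obtain ⟨γ, s, t, hst, hc, hi, rfl, rfl, rfl⟩ := h
  have hlt : s < t := hst.lt_of_ne (fun h => hxy (by rw [h]))
  have h1 : Tendsto γ (𝓝[<] t) (𝓝 (γ t)) := by
    have := (hc t ⟨hst, le_rfl⟩).mono (Ico_subset_Icc_self)
    rwa [ContinuousWithinAt, nhdsWithin_Ico_eq_nhdsLT hlt] at this
  obtain ⟨r, hr, hrU⟩ := (Filter.Eventually.and (Ico_mem_nhdsLT hlt) (h1 hU)).exists
  refine ⟨γ r, ⟨r, Ico_subset_Icc_self hr, rfl⟩, hrU, fun h => ?_⟩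
  exact hr.2.ne (hi (Ico_subset_Icc_self hr) ⟨hst, le_rfl⟩ h)

theorem of_path {γ : Path x y} (hγ : Function.Injective γ) : IsArcBetween x y (range γ) := by
  refine ⟨γ.extend, 0, 1, zero_le_one, γ.continuous_extend.continuousOn, ?_, by simp, by simp, ?_⟩
  · intro a ha b hb h
    rw [γ.extend_apply ha, γ.extend_apply hb] at h
    simpa using hγ h
  · ext w; constructor
    · rintro ⟨r, hr, rfl⟩; exact ⟨⟨r, hr⟩, by rw [γ.extend_apply hr]⟩
    · rintro ⟨r, rfl⟩; exact ⟨r, r.2, by rw [γ.extend_apply r.2]⟩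

theorem exists_path (h : IsArcBetween x y S) (hxy : x ≠ y) :
    ∃ γ : Path x y, Function.Injective γ ∧ range γ = S := by
  obtain ⟨γ, s, t, hst, hc, hi, rfl, rfl, rfl⟩ := h
  have hlt : 0 < t - s := sub_pos.2 (hst.lt_of_ne (fun h => hxy (by rw [h])))
  have hm : ∀ r : unitInterval, s + r * (t - s) ∈ Icc s t := fun r =>
    ⟨by nlinarith [r.2.1], by nlinarith [r.2.2]⟩
  refine ⟨⟨⟨fun r => γ (s + r * (t - s)), ?_⟩, by simp, by simp⟩, ?_, ?_⟩
  · exact hc.comp_continuous (by fun_prop) hm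
  · intro a b h
    have := hi (hm a) (hm b) h
    exact Subtype.ext (by simpa [hlt.ne'] using this)
  · ext w; constructor
    · rintro ⟨r, rfl⟩; exact ⟨_, hm r, rfl⟩
    · rintro ⟨r, hr, rfl⟩
      refine ⟨⟨(r - s) / (t - s), div_nonneg (by linarith [hr.1]) hlt.le,
        (div_le_one hlt).2 (by linarith [hr.2])⟩, ?_⟩
      show γ (s + (r - s) / (t - s) * (t - s)) = γ r
      rw [div_mul_cancel₀ _ hlt.ne']; congr 1; ring

/-- If an arc is contained in another one near one of its interior points, then the two arcs
agree near this point. -/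
theorem eventually_mem_iff [T2Space X] {x' y' : X} (h : IsArcBetween x y S)
    (h' : IsArcBetween x' y' T) (hz : z ∈ S) (hzx : z ≠ x) (hzy : z ≠ y)
    (hST : ∀ᶠ w in 𝓝 z, w ∈ S → w ∈ T) : ∀ᶠ w in 𝓝 z, w ∈ S ↔ w ∈ T := by
  obtain ⟨α, s, t, hst, hc, hi, rfl, rfl, rfl⟩ := h
  obtain ⟨β, a, b, hab, hc', hi', rfl, rfl, rfl⟩ := h'
  obtain ⟨r, hr, rfl⟩ := hz
  have hsr : s < r := hr.1.lt_of_ne (fun h => hzx (by rw [h]))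
  have hrt : r < t := hr.2.lt_of_ne (fun h => hzy (by rw [h]))
  set g := Function.invFunOn β (Icc a b) with hg
  have gmem : ∀ w ∈ β '' Icc a b, g w ∈ Icc a b := fun w hw => Function.invFunOn_mem hw
  have geq : ∀ w ∈ β '' Icc a b, β (g w) = w := fun w hw => Function.invFunOn_eq hw
  -- The inverse of the parametrisation is continuous because closed subsets of a compact interval
  -- have closed images.
  have gc : ContinuousOn g (β '' Icc a b) := by
    rw [continuousOn_iff_isClosed]
    intro C hC
    refine ⟨β '' (Icc a b ∩ C), ((isCompact_Icc.inter_right hC).image_of_continuousOn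
      (hc'.mono inter_subset_left)).isClosed, ?_⟩
    ext w; constructor
    · rintro ⟨h1, h2⟩
      exact ⟨⟨g w, ⟨gmem w h2, h1⟩, geq w h2⟩, h2⟩
    · rintro ⟨⟨q, ⟨hq, hqC⟩, rfl⟩, h2⟩
      refine ⟨?_, h2⟩
      have : g (β q) = q := hi' (gmem _ h2) hq (geq _ h2)
      simpa [this] using hqC
  have hcr : ContinuousAt α r := (hc r hr).continuousAt (Icc_mem_nhds hsr hrt)
  have hev : ∀ᶠ q in 𝓝 r, q ∈ Icc s t ∧ (α q ∈ α '' Icc s t → α q ∈ β '' Icc a b) :=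
    (show ∀ᶠ q in 𝓝 r, q ∈ Icc s t from Icc_mem_nhds hsr hrt).and (hcr.eventually hST)
  obtain ⟨ε, hε, hball⟩ := Metric.nhds_basis_closedBall.eventually_iff.1 hev
  rw [Real.closedBall_eq_Icc] at hball
  have hb : ∀ q ∈ Icc (r - ε) (r + ε), q ∈ Icc s t ∧ α q ∈ β '' Icc a b := fun q hq =>
    ⟨(hball hq).1, (hball hq).2 ⟨q, (hball hq).1, rfl⟩⟩
  -- The change of parameter `k` is continuous and injective on an interval, hence strictly
  -- monotone, so its image is a neighbourhood of `k r`. Points of `T` near `γ r` have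
  -- `β`-parameters there and so lie on the first arc.
  set k := fun q => g (α q) with hk
  have kc : ContinuousOn k (Icc (r - ε) (r + ε)) :=
    gc.comp (hc.mono fun q hq => (hb q hq).1) fun q hq => (hb q hq).2
  have ki : InjOn k (Icc (r - ε) (r + ε)) := by
    intro p hp q hq h
    refine hi (hb p hp).1 (hb q hq).1 ?_
    rw [← geq _ (hb p hp).2, ← geq _ (hb q hq).2]
    exact congrArg β h
  have m1 : r - ε ∈ Icc (r - ε) (r + ε) := ⟨le_rfl, by linarith⟩
  have m2 : r ∈ Icc (r - ε) (r + ε) := ⟨by linarith, by linarith⟩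
  have m3 : r + ε ∈ Icc (r - ε) (r + ε) := ⟨by linarith, le_rfl⟩
  have hN : k '' Icc (r - ε) (r + ε) ∈ 𝓝 (k r) := by
    rcases kc.strictMonoOn_of_injOn_Icc' (by linarith) ki with hm | hm
    · exact mem_of_superset (Icc_mem_nhds (hm m1 m2 (by linarith)) (hm m2 m3 (by linarith)))
        (intermediate_value_Icc (by linarith) kc)
    · exact mem_of_superset (Icc_mem_nhds (hm m2 m3 (by linarith)) (hm m1 m2 (by linarith)))
        (intermediate_value_Icc' (by linarith) kc)
  have h1 := eventually_nhdsWithin_iff.1 ((gc _ (hb r m2).2).eventually hN)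
  filter_upwards [h1, hST] with w hw hw'
  refine ⟨hw', fun hT => ?_⟩
  obtain ⟨q, hq, hqw⟩ := hw hT
  refine ⟨q, (hb q hq).1, ?_⟩
  rw [← geq _ (hb q hq).2, ← geq w hT]
  exact congrArg β hqw

end

end IsArcBetween

/-! ### Crossing points in local coordinates. -/

namespace CrossesAt

open Set Filter Topology

theorem symm {A B : Set Plane} {x : Plane} (h : CrossesAt A B x) : CrossesAt B A x := by
  obtain ⟨φ, hx, hx0, hφ⟩ := h
  let ψ : Plane ≃ₜ Plane :=
    (LinearIsometryEquiv.piLpCongrLeft 2 ℝ ℝ (Equiv.swap (0 : Fin 2) 1)).toHomeomorph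
  have h0 : ∀ y : Plane, ψ y 0 = y 1 := fun y => by
    simp [ψ, Equiv.piCongrLeft'_apply]
  have h1 : ∀ y : Plane, ψ y 1 = y 0 := fun y => by
    simp [ψ, Equiv.piCongrLeft'_apply]
  refine ⟨φ.transHomeomorph ψ, hx, ?_, fun y hy => ?_⟩
  · have : ψ (φ x) = 0 := by
      rw [hx0]; ext i; fin_cases i <;> simp [h0, h1]
    simpa using this
  · simpa [h0, h1] using (hφ y hy).symm

theorem congr {A B A' B' : Set Plane} {x : Plane} (h : CrossesAt A B x)
    (hA : ∀ᶠ w in 𝓝 x, w ∈ A' ↔ w ∈ A) (hB : ∀ᶠ w in 𝓝 x, w ∈ B' ↔ w ∈ B) :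
    CrossesAt A' B' x := by
  obtain ⟨φ, hx, hx0, hφ⟩ := h
  obtain ⟨U, hU, hUo, hxU⟩ := eventually_nhds_iff.1 (hA.and hB)
  refine ⟨φ.restrOpen U hUo, ⟨hx, hxU⟩, hx0, fun y hy => ?_⟩
  rw [OpenPartialHomeomorph.restrOpen_source] at hy
  rw [(hU y hy.2).1, (hU y hy.2).2]
  exact hφ y hy.1

theorem mem_left {A B : Set Plane} {x : Plane} (h : CrossesAt A B x) : x ∈ A := by
  obtain ⟨φ, hx, hx0, hφ⟩ := h
  exact (hφ x hx).1.2 (by rw [hx0]; rfl)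

/-- Near a crossing, points of the two curves are joined by arcs that avoid the curves. -/
theorem exists_chord {P Q N : Set Plane} {x : Plane} (hc : CrossesAt P Q x) (hN : N ∈ 𝓝 x) :
    ∃ U ∈ 𝓝 x, ∀ y ∈ P ∩ U, ∀ z ∈ Q ∩ U, y ≠ x → z ≠ x →
      ∃ K ⊆ N, IsArcBetween y z K ∧ (∀ w ∈ K, w ∈ P → w = y) ∧ ∀ w ∈ K, w ∈ Q → w = z := by
  obtain ⟨φ, hx, hx0, hφ⟩ := hc
  have h2 : ∀ᶠ w in 𝓝 (φ x), w ∈ φ.target ∧ φ.symm w ∈ N := by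
    refine Filter.Eventually.and (φ.open_target.mem_nhds (φ.map_source hx)) ?_
    have := φ.continuousAt_symm (φ.map_source hx)
    rw [ContinuousAt, φ.left_inv hx] at this
    exact this hN
  rw [hx0] at h2
  obtain ⟨ε, hε, hball⟩ := Metric.eventually_nhds_iff_ball.1 h2
  refine ⟨φ.source ∩ φ ⁻¹' Metric.ball 0 ε, inter_mem (φ.open_source.mem_nhds hx)
      ((φ.continuousAt hx) (by rw [hx0]; exact Metric.ball_mem_nhds _ hε)), ?_⟩
  rintro y ⟨hyP', hys, hyb⟩ z ⟨hzQ', hzs, hzb⟩ hyx hzx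
  rw [mem_preimage] at hyb hzb
  have hconv : Convex ℝ (Metric.ball (0 : Plane) ε) := convex_ball 0 ε
  have hyP : φ y 1 = 0 := (hφ y hys).1.1 hyP'
  have hzQ : φ z 0 = 0 := (hφ z hzs).2.1 hzQ'
  have hy0 : φ y 0 ≠ 0 := by
    intro h
    apply hyx
    apply φ.injOn hys hx
    rw [hx0]
    ext i; fin_cases i
    exacts [h, hyP]
  have hz0 : φ z 1 ≠ 0 := by
    intro h
    apply hzx
    apply φ.injOn hzs hx
    rw [hx0]
    ext i; fin_cases i
    exacts [hzQ, h]
  -- In the coordinates of the crossing, the segment from a nonzero point of one axis to a nonzero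
  -- point of the other meets each axis only at its end. It stays in the ball by convexity.
  obtain ⟨σ, hσ⟩ : ∃ σ : ℝ → Plane, σ = fun r => (1 - r) • φ y + r • φ z := ⟨_, rfl⟩
  have σc : Continuous σ := by rw [hσ]; fun_prop
  have σ0 : σ 0 = φ y := by simp [hσ]
  have σ1 : σ 1 = φ z := by simp [hσ]
  have s0 : ∀ r, σ r 0 = (1 - r) * φ y 0 := fun r => by simp [hσ, hzQ]
  have s1 : ∀ r, σ r 1 = r * φ z 1 := fun r => by simp [hσ, hyP]
  have sb : ∀ r ∈ Icc (0 : ℝ) 1, σ r ∈ Metric.ball 0 ε := fun r hr => by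
    rw [hσ]
    exact hconv hyb hzb (sub_nonneg.2 hr.2) hr.1 (sub_add_cancel 1 r)
  have st : ∀ r ∈ Icc (0 : ℝ) 1, σ r ∈ φ.target := fun r hr => (hball _ (sb r hr)).1
  refine ⟨(fun r => φ.symm (σ r)) '' Icc 0 1, ?_, ?_, ?_, ?_⟩
  · rintro _ ⟨r, hr, rfl⟩
    exact (hball _ (sb r hr)).2
  · refine ⟨fun r => φ.symm (σ r), 0, 1, zero_le_one, ?_, ?_, ?_, ?_, rfl⟩
    · exact φ.continuousOn_symm.comp σc.continuousOn st
    · intro p hp q hq h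
      have h' := φ.symm.injOn (st p hp) (st q hq) h
      have := s1 p
      rw [h', s1 q] at this
      exact (mul_right_cancel₀ hz0 this).symm
    · beta_reduce; rw [σ0, φ.left_inv hys]
    · beta_reduce; rw [σ1, φ.left_inv hzs]
  · rintro _ ⟨r, hr, rfl⟩ h
    have := (hφ _ (φ.map_target (st r hr))).1.1 h
    rw [φ.right_inv (st r hr), s1] at this
    have : r = 0 := (mul_eq_zero.1 this).resolve_right hz0
    beta_reduce; rw [this, σ0, φ.left_inv hys]
  · rintro _ ⟨r, hr, rfl⟩ h
    have := (hφ _ (φ.map_target (st r hr))).2.1 h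
    rw [φ.right_inv (st r hr), s0] at this
    have : r = 1 := by linarith [(mul_eq_zero.1 this).resolve_right hy0]
    beta_reduce; rw [this, σ1, φ.left_inv hzs]

end CrossesAt

/-! ### Interchanging segments of two arcs. -/

namespace IsArcBetween

open Set Filter Topology

/-- Cutting a corner: where two arcs follow the first and the second of two crossing curves,
respectively, up to the crossing point, their union can be modified near the crossing point so as
to avoid it. -/
theorem cut_corner {u v x : Plane} {A B P Q O : Set Plane} (hA : IsArcBetween u x A)
    (hB : IsArcBetween x v B) (hAB : A ∩ B ⊆ {x}) (hu : u ≠ x) (hv : v ≠ x)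
    (hc : CrossesAt P Q x) (hP : ∀ᶠ w in 𝓝 x, w ∈ A → w ∈ P) (hQ : ∀ᶠ w in 𝓝 x, w ∈ B → w ∈ Q)
    (hO : O ∈ 𝓝 x) :
    ∃ C K, IsArcBetween u v C ∧ IsClosed K ∧ K ⊆ O ∧ C ⊆ A ∪ B ∪ K ∧ C ∩ (P ∪ Q) ⊆ A ∪ B ∧
      x ∉ C := by
  have hN : {w | (w ∈ A → w ∈ P) ∧ (w ∈ B → w ∈ Q) ∧ w ∈ O} ∈ 𝓝 x := hP.and (hQ.and hO)
  obtain ⟨U, hU, hchord⟩ := hc.exists_chord hN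
  have hUN := inter_mem hU hN
  obtain ⟨y, hyA, ⟨hyU, hyN⟩, hyx⟩ := hA.exists_mem_nhds_ne hu hUN
  obtain ⟨z, hzB, ⟨hzU, hzN⟩, hzx⟩ := hB.symm.exists_mem_nhds_ne hv hUN
  obtain ⟨K, hKN, hKarc, KP, KQ⟩ := hchord y ⟨hyN.1 hyA, hyU⟩ z ⟨hzN.2.1 hzB, hzU⟩ hyx hzx
  -- The part `A₂ ∪ B₁` through `x` is replaced by the chord `K`, which meets `P` only at `y` and
  -- `Q` only at `z`.
  obtain ⟨A₁, A₂, hA₁, hA₂, rfl, hA₁₂⟩ := hA.split hyA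
  obtain ⟨B₁, B₂, hB₁, hB₂, rfl, hB₁₂⟩ := hB.split hzB
  have xA₁ : x ∉ A₁ := fun h => hyx (hA₁₂ ⟨h, hA₂.right_mem⟩).symm
  have xB₂ : x ∉ B₂ := fun h => hzx (hB₁₂ ⟨hB₁.left_mem, h⟩).symm
  refine ⟨A₁ ∪ K ∪ B₂, K, ?_, hKarc.isClosed, fun w hw => (hKN hw).2.2, ?_, ?_, ?_⟩
  · refine (hA₁.concat hKarc ?_).concat hB₂ ?_
    · rintro w ⟨h1, h2⟩
      exact KP w h2 ((hKN h2).1 (Or.inl h1))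
    · rintro w ⟨h1 | h1, h2⟩
      · have := hAB ⟨Or.inl h1, Or.inr h2⟩
        exact absurd (this ▸ h1) xA₁
      · exact KQ w h1 ((hKN h1).2.1 (Or.inr h2))
  · rintro w ((h | h) | h)
    exacts [Or.inl (Or.inl (Or.inl h)), Or.inr h, Or.inl (Or.inr (Or.inr h))]
  · rintro w ⟨(h | h) | h, h'⟩
    · exact Or.inl (Or.inl h)
    · rcases h' with h' | h'
      · rw [KP w h h']; exact Or.inl hyA
      · rw [KQ w h h']; exact Or.inr hzB
    · exact Or.inr (Or.inr h)
  · rintro ((h | h) | h)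
    exacts [xA₁ h, hyx (KP x h hc.mem_left).symm, xB₂ h]

end IsArcBetween

namespace IsArcBetween

open Set Filter Topology

section

variable {X : Type*} [TopologicalSpace X] {x y : X} {S : Set X}

/-- Two consecutive points of a finite set along an arc. -/
theorem exists_consecutive (h : IsArcBetween x y S) {F : Set X} (hF : F.Finite) (hFS : F ⊆ S)
    (hnt : F.Nontrivial) :
    ∃ p ∈ F, ∃ q ∈ F, p ≠ q ∧ ∃ S₁ S₂ S₃, IsArcBetween x p S₁ ∧ IsArcBetween p q S₂ ∧
      IsArcBetween q y S₃ ∧ S₁ ∪ S₂ ∪ S₃ = S ∧ S₁ ∩ S₂ ⊆ {p} ∧ S₂ ∩ S₃ ⊆ {q} ∧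
      Disjoint S₁ S₃ ∧ F ∩ S₂ ⊆ {p, q} := by
  obtain ⟨γ, s, t, hst, hc, hi, rfl, rfl, rfl⟩ := h
  have hfin : (Icc s t ∩ γ ⁻¹' F).Finite :=
    Finite.of_finite_image (hF.subset (by rintro _ ⟨r, hr, rfl⟩; exact hr.2))
      (hi.mono inter_subset_left)
  have hpre : ∀ w ∈ F, ∃ r ∈ Icc s t ∩ γ ⁻¹' F, γ r = w := fun w hw => by
    obtain ⟨r, hr, rfl⟩ := hFS hw
    exact ⟨r, ⟨hr, hw⟩, rfl⟩
  obtain ⟨w₁, hw₁, w₂, hw₂, hne⟩ := hnt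
  obtain ⟨r₁, h₁, rfl⟩ := hpre w₁ hw₁
  obtain ⟨r₂, h₂, rfl⟩ := hpre w₂ hw₂
  obtain ⟨a, ⟨ha, haF⟩, hamin⟩ := hfin.isCompact.exists_isLeast ⟨r₁, h₁⟩
  have hfin' : ((Icc s t ∩ γ ⁻¹' F) \ {a}).Finite := hfin.sdiff
  obtain ⟨b, ⟨⟨hb, hbF⟩, hba⟩, hbmin⟩ := hfin'.isCompact.exists_isLeast (by
    by_cases h : r₁ = a
    · exact ⟨r₂, h₂, fun h' => hne (by rw [h, ← mem_singleton_iff.1 h'])⟩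
    · exact ⟨r₁, h₁, h⟩)
  have hab : a < b := (hamin ⟨hb, hbF⟩).lt_of_ne (Ne.symm hba)
  refine ⟨γ a, haF, γ b, hbF, fun h => hba (hi hb ha h.symm), _, _, _,
    subarc hc hi le_rfl ha.1 ha.2, subarc hc hi ha.1 hab.le hb.2, subarc hc hi hb.1 hb.2 le_rfl,
    ?_, ?_, ?_, ?_, ?_⟩
  · rw [← image_union, ← image_union, Icc_union_Icc_eq_Icc ha.1 hab.le,
      Icc_union_Icc_eq_Icc hb.1 hb.2]
  · rintro _ ⟨⟨p, hp, rfl⟩, q, hq, h⟩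
    have : q = p := hi ⟨ha.1.trans hq.1, hq.2.trans hb.2⟩ ⟨hp.1, hp.2.trans ha.2⟩ h
    rw [le_antisymm hp.2 (this ▸ hq.1)]; rfl
  · rintro _ ⟨⟨p, hp, rfl⟩, q, hq, h⟩
    have : q = p := hi ⟨hb.1.trans hq.1, hq.2⟩ ⟨ha.1.trans hp.1, hp.2.trans hb.2⟩ h
    rw [le_antisymm hp.2 (this ▸ hq.1)]; rfl
  · rw [disjoint_left]
    rintro _ ⟨p, hp, rfl⟩ ⟨q, hq, h⟩
    have : q = p := hi ⟨hb.1.trans hq.1, hq.2⟩ ⟨hp.1, hp.2.trans ha.2⟩ h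
    linarith [hp.2, hq.1]
  · rintro _ ⟨hF, p, hp, rfl⟩
    by_cases hpa : p = a
    · left; rw [hpa]
    · right
      have := hbmin ⟨⟨⟨ha.1.trans hp.1, hp.2.trans hb.2⟩, hF⟩, hpa⟩
      rw [le_antisymm hp.2 this]; rfl

/-- An arc is cut into three by two of its points, possibly after reversing it. -/
theorem exists_three (h : IsArcBetween x y S) {p q : X} (hp : p ∈ S) (hq : q ∈ S) (hpq : p ≠ q) :
    ∃ x' y', (x' = x ∧ y' = y ∨ x' = y ∧ y' = x) ∧
      ∃ S₁ S₂ S₃, IsArcBetween x' p S₁ ∧ IsArcBetween p q S₂ ∧ IsArcBetween q y' S₃ ∧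
        S₁ ∪ S₂ ∪ S₃ = S ∧ S₁ ∩ S₂ ⊆ {p} ∧ S₂ ∩ S₃ ⊆ {q} ∧ Disjoint S₁ S₃ := by
  obtain ⟨A, B, hA, hB, rfl, hAB⟩ := h.split hp
  rcases hq with hq | hq
  · obtain ⟨A₁, A₂, hA₁, hA₂, rfl, hA₁₂⟩ := hA.split hq
    refine ⟨y, x, Or.inr ⟨rfl, rfl⟩, B, A₂, A₁, hB.symm, hA₂.symm, hA₁.symm, ?_, ?_, ?_, ?_⟩
    · rw [union_comm, union_comm B, union_assoc]
    · exact fun w hw => hAB ⟨Or.inr hw.2, hw.1⟩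
    · exact fun w hw => hA₁₂ ⟨hw.2, hw.1⟩
    · rw [disjoint_left]
      intro w hwB hwA
      have : w = p := hAB ⟨Or.inl hwA, hwB⟩
      exact hpq (hA₁₂ ⟨this ▸ hwA, hA₂.right_mem⟩)
  · obtain ⟨B₁, B₂, hB₁, hB₂, rfl, hB₁₂⟩ := hB.split hq
    refine ⟨x, y, Or.inl ⟨rfl, rfl⟩, A, B₁, B₂, hA, hB₁, hB₂, union_assoc .., ?_, hB₁₂, ?_⟩
    · exact fun w hw => hAB ⟨hw.1, Or.inl hw.2⟩
    · rw [disjoint_left]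
      intro w hwA hwB
      have : w = p := hAB ⟨hwA, Or.inr hwB⟩
      exact hpq (hB₁₂ ⟨hB₁.left_mem, this ▸ hwB⟩)

end

/-- Two arcs that meet at `x` are joined to one that avoids `x` unless `x` is a vertex. -/
theorem exists_joint {u v x : Plane} {A B P Q O V : Set Plane} (hA : IsArcBetween u x A)
    (hB : IsArcBetween x v B) (hAB : A ∩ B ⊆ {x})
    (hP : ∀ᶠ w in 𝓝 x, w ∈ A → w ∈ P) (hQ : ∀ᶠ w in 𝓝 x, w ∈ B → w ∈ Q)
    (hx : x ∉ V → u ≠ x ∧ v ≠ x ∧ CrossesAt P Q x ∧ O ∈ 𝓝 x) :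
    ∃ C K, IsArcBetween u v C ∧ IsClosed K ∧ K ⊆ O ∧ C ⊆ A ∪ B ∪ K ∧ C ∩ (P ∪ Q) ⊆ A ∪ B ∧
      (x ∉ V → x ∉ C) := by
  by_cases hxV : x ∈ V
  · exact ⟨A ∪ B, ∅, hA.concat hB hAB, isClosed_empty, empty_subset _, by simp,
      inter_subset_left, fun h => absurd hxV h⟩
  · obtain ⟨hu, hv, hc, hO⟩ := hx hxV
    obtain ⟨C, K, h1, h2, h3, h4, h5, h6⟩ := cut_corner hA hB hAB hu hv hc hP hQ hO
    exact ⟨C, K, h1, h2, h3, h4, h5, fun _ => h6⟩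

/-- The result of interchanging segments of two arcs `P` and `Q` between two common points:
the arcs `P'` and `Q'` have fewer common points. Here `V` is the set of vertices, and the change
takes place in `P ∪ Q` and in a closed set `K`. -/
structure IsSwap (V P Q K P' Q' : Set Plane) : Prop where
  isClosed : IsClosed K
  subset_left : P' ⊆ P ∪ Q ∪ K
  subset_right : Q' ⊆ P ∪ Q
  inter_subset : P' ∩ Q' ⊆ P ∩ Q
  vertex_left : V ∩ P' ⊆ P
  vertex_right : V ∩ Q' ⊆ Q
  crossesAt : ∀ x ∈ P' ∩ Q', x ∉ V → CrossesAt P' Q' x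
  germ_left : ∀ x ∈ P', x ∉ V → x ∉ K → x ∉ P ∩ Q →
    x ∈ P ∧ (∀ᶠ w in 𝓝 x, w ∈ P' ↔ w ∈ P) ∨ x ∈ Q ∧ (∀ᶠ w in 𝓝 x, w ∈ P' ↔ w ∈ Q)
  germ_right : ∀ x ∈ Q', x ∉ V → x ∉ P ∩ Q →
    x ∈ P ∧ (∀ᶠ w in 𝓝 x, w ∈ Q' ↔ w ∈ P) ∨ x ∈ Q ∧ (∀ᶠ w in 𝓝 x, w ∈ Q' ↔ w ∈ Q)
  exists_removed : ∃ x ∈ P ∩ Q, x ∉ V ∧ x ∉ P' ∩ Q'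

/-- `P'` follows `A₁`, `B₂`, `A₃` with the corners at `p` and `q` cut unless they are vertices; it
is an arc because `B₂` meets `P` only at `p` and `q`. `Q'` runs inside `B₁ ∪ A₂ ∪ B₃`. It may bend
at `p` and `q`, since `P'` no longer passes through those of them that are not vertices. -/
theorem exists_isSwap_of_three {u v u' v' p q a b a' b' : Plane} {A₁ A₂ A₃ B₁ B₂ B₃ O V : Set Plane}
    (hA₁ : IsArcBetween u p A₁) (hA₂ : IsArcBetween p q A₂) (hA₃ : IsArcBetween q v A₃)
    (hB₁ : IsArcBetween u' p B₁) (hB₂ : IsArcBetween p q B₂) (hB₃ : IsArcBetween q v' B₃)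
    (hpq : p ≠ q) (hA₁₂ : A₁ ∩ A₂ ⊆ {p}) (hA₂₃ : A₂ ∩ A₃ ⊆ {q}) (hA₁₃ : Disjoint A₁ A₃)
    (hB₁₂ : B₁ ∩ B₂ ⊆ {p}) (hB₂₃ : B₂ ∩ B₃ ⊆ {q})
    {P Q : Set Plane} (hP : IsArcBetween a b P) (hQ : IsArcBetween a' b' Q) (hPA : A₁ ∪ A₂ ∪ A₃ = P) (hQB : B₁ ∪ B₂ ∪ B₃ = Q)
    (hF : P ∩ B₂ ⊆ {p, q}) (hfin : (P ∩ Q).Finite)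
    (hu : u ∈ V) (hv : v ∈ V) (hu' : u' ∈ V) (hv' : v' ∈ V) (hVP : V ∩ P ⊆ {u, v})
    (hVQ : V ∩ Q ⊆ {u', v'}) (hc : ∀ x ∈ P ∩ Q, x ∉ V → CrossesAt P Q x)
    (hsub : (V ∩ (P ∩ Q)).Subsingleton) (hO : ∀ x ∈ P ∩ Q, x ∉ V → O ∈ 𝓝 x) (hOV : Disjoint O V) :
    ∃ P' Q' K, IsArcBetween u v P' ∧ IsArcBetween u' v' Q' ∧ K ⊆ O ∧ IsSwap V P Q K P' Q' := by
  have A₁P : A₁ ⊆ P := hPA ▸ fun w h => Or.inl (Or.inl h)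
  have A₂P : A₂ ⊆ P := hPA ▸ fun w h => Or.inl (Or.inr h)
  have A₃P : A₃ ⊆ P := hPA ▸ fun w h => Or.inr h
  have B₁Q : B₁ ⊆ Q := hQB ▸ fun w h => Or.inl (Or.inl h)
  have B₂Q : B₂ ⊆ Q := hQB ▸ fun w h => Or.inl (Or.inr h)
  have B₃Q : B₃ ⊆ Q := hQB ▸ fun w h => Or.inr h
  have hPcl : IsClosed P := hP.isClosed
  have hQcl : IsClosed Q := hQ.isClosed
  have pPQ : p ∈ P ∩ Q := ⟨A₂P hA₂.left_mem, B₂Q hB₂.left_mem⟩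
  have qPQ : q ∈ P ∩ Q := ⟨A₂P hA₂.right_mem, B₂Q hB₂.right_mem⟩
  have pA₃ : p ∉ A₃ := disjoint_left.1 hA₁₃ hA₁.right_mem
  have qA₁ : q ∉ A₁ := disjoint_right.1 hA₁₃ hA₃.left_mem
  have near : ∀ {C : Set Plane} {x : Plane}, IsClosed C → x ∉ C → ∀ᶠ w in 𝓝 x, w ∉ C :=
    fun hC hx => hC.compl_mem_nhds hx
  -- The chord at one common point must keep away from all the others.
  have hO' : ∀ x ∈ P ∩ Q, x ∉ V → O ∩ ((P ∩ Q) \ {x})ᶜ ∈ 𝓝 x := fun x hx hxV =>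
    inter_mem (hO x hx hxV) ((hfin.subset sdiff_subset).isClosed.compl_mem_nhds (by simp))
  obtain ⟨C, K₁, hC, hK₁, hK₁O, hCsub, hCPQ, hpC⟩ :=
    exists_joint (P := P) (Q := Q) (V := V) (O := O ∩ ((P ∩ Q) \ {p})ᶜ) hA₁ hB₂
      (fun w hw => by
        rcases hF ⟨A₁P hw.1, hw.2⟩ with h | h
        · exact h
        · rw [h] at hw; exact absurd hw.1 qA₁)
      (Eventually.of_forall A₁P) (Eventually.of_forall B₂Q)
      (fun h => ⟨fun h' => h (h' ▸ hu), hpq.symm, hc p pPQ h, hO' p pPQ h⟩)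
  have qK₁ : q ∉ K₁ := fun h => (hK₁O h).2 ⟨qPQ, hpq.symm⟩
  -- At `q` the roles of the curves are reversed: the new arc arrives along `Q` and leaves along
  -- `P`.
  obtain ⟨P', K₂, hP', hK₂, hK₂O, hP'sub, hP'PQ, hqP'⟩ :=
    exists_joint (P := Q) (Q := P) (V := V) (O := O ∩ ((P ∩ Q) \ {q})ᶜ) hC hA₃
      (fun w hw => by
        rcases hCPQ ⟨hw.1, Or.inl (A₃P hw.2)⟩ with h | h
        · exact absurd hw.2 (disjoint_left.1 hA₁₃ h)
        · rcases hF ⟨A₃P hw.2, h⟩ with h | h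
          · rw [h] at hw; exact absurd hw.2 pA₃
          · exact h)
      (by
        filter_upwards [near hA₁.isClosed qA₁, near hK₁ qK₁] with w h1 h2 h3
        rcases hCsub h3 with (h | h) | h
        exacts [absurd h h1, B₂Q h, absurd h h2])
      (Eventually.of_forall A₃P)
      (fun h => ⟨fun h' => h (h' ▸ hu), fun h' => h (h' ▸ hv), (hc q qPQ h).symm, hO' q qPQ h⟩)
  -- `A₂` may meet `B₁` and `B₃` elsewhere, so the union need not be an arc, but it contains one.
  obtain ⟨D, hDsub, hD⟩ := hB₁.exists_subset_union hA₂
  obtain ⟨Q', hQ'sub', hQ'⟩ := hD.exists_subset_union hB₃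
  have hQ'sub : Q' ⊆ B₁ ∪ A₂ ∪ B₃ := hQ'sub'.trans (union_subset_union_left _ hDsub)
  have hP'R : P' ∩ (P ∪ Q) ⊆ A₁ ∪ B₂ ∪ A₃ := by
    rintro w ⟨h1, h2⟩
    rcases hP'PQ ⟨h1, h2.symm⟩ with h | h
    · exact Or.inl (hCPQ ⟨h, h2⟩)
    · exact Or.inr h
  have hP'sub' : P' ⊆ A₁ ∪ B₂ ∪ A₃ ∪ (K₁ ∪ K₂) := by
    intro w h1
    rcases hP'sub h1 with (h | h) | h
    · rcases hCsub h with h | h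
      exacts [Or.inl (Or.inl h), Or.inr (Or.inl h)]
    · exact Or.inl (Or.inr h)
    · exact Or.inr (Or.inr h)
  have hKO : K₁ ∪ K₂ ⊆ O := union_subset (fun w h => (hK₁O h).1) (fun w h => (hK₂O h).1)
  have hKcl : IsClosed (K₁ ∪ K₂) := hK₁.union hK₂
  have hKPQ : ∀ x ∈ P ∩ Q, x ≠ p → x ≠ q → x ∉ K₁ ∪ K₂ := by
    rintro x hx hxp hxq (h | h)
    exacts [(hK₁O h).2 ⟨hx, hxp⟩, (hK₂O h).2 ⟨hx, hxq⟩]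
  have hR : A₁ ∪ B₂ ∪ A₃ ⊆ P ∪ Q :=
    union_subset (union_subset (fun w h => Or.inl (A₁P h)) (fun w h => Or.inr (B₂Q h)))
      (fun w h => Or.inl (A₃P h))
  have hR' : B₁ ∪ A₂ ∪ B₃ ⊆ P ∪ Q :=
    union_subset (union_subset (fun w h => Or.inr (B₁Q h)) (fun w h => Or.inl (A₂P h)))
      (fun w h => Or.inr (B₃Q h))
  have hpP' : p ∉ V → p ∉ P' := by
    intro hpV h
    rcases hP'PQ ⟨h, Or.inr pPQ.1⟩ with h | h
    exacts [hpC hpV h, pA₃ h]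
  have hinter : P' ∩ Q' ⊆ P ∩ Q := by
    rintro w ⟨h1, h2⟩
    have h2' := hQ'sub h2
    have hw := hP'R ⟨h1, hR' h2'⟩
    rcases hw with (hw | hw) | hw
    · rcases h2' with (h | h) | h
      · exact ⟨A₁P hw, B₁Q h⟩
      · rw [show w = p from hA₁₂ ⟨hw, h⟩]; exact pPQ
      · exact ⟨A₁P hw, B₃Q h⟩
    · rcases h2' with (h | h) | h
      · rw [show w = p from hB₁₂ ⟨h, hw⟩]; exact pPQ
      · exact ⟨A₂P h, B₂Q hw⟩
      · rw [show w = q from hB₂₃ ⟨hw, h⟩]; exact qPQ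
    · rcases h2' with (h | h) | h
      · exact ⟨A₃P hw, B₁Q h⟩
      · rw [show w = q from hA₂₃ ⟨h, hw⟩]; exact qPQ
      · exact ⟨A₃P hw, B₃Q h⟩
  have hend : ∀ {x}, x ∉ V → x ≠ u ∧ x ≠ v ∧ x ≠ u' ∧ x ≠ v' := fun hx =>
    ⟨fun h => hx (h ▸ hu), fun h => hx (h ▸ hv), fun h => hx (h ▸ hu'), fun h => hx (h ▸ hv')⟩
  -- A vertex on `B₂` is an end of `Q`, which can lie on the middle segment only if it is `p` or
  -- `q`.
  have ends : ∀ x ∈ V, x ∈ B₂ → x ∈ P := by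
    intro x hxV hx
    rcases hVQ ⟨hxV, B₂Q hx⟩ with rfl | rfl
    · rw [show x = p from hB₁₂ ⟨hB₁.left_mem, hx⟩]; exact pPQ.1
    · rw [show x = q from hB₂₃ ⟨hx, hB₃.right_mem⟩]; exact qPQ.1
  refine ⟨P', Q', K₁ ∪ K₂, hP', hQ', hKO, hKcl, ?_, hQ'sub.trans hR', hinter, ?_, ?_, ?_, ?_, ?_,
    ?_⟩
  · exact hP'sub'.trans (union_subset_union_left _ hR)
  · rintro x ⟨hxV, hx⟩
    rcases hP'sub' hx with ((h | h) | h) | h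
    · exact A₁P h
    · exact ends x hxV h
    · exact A₃P h
    · exact absurd hxV (disjoint_left.1 hOV (hKO h))
  · rintro x ⟨hxV, hx⟩
    rcases hQ'sub hx with (h | h) | h
    · exact B₁Q h
    · rcases hVP ⟨hxV, A₂P h⟩ with rfl | rfl
      · rw [show x = p from hA₁₂ ⟨hA₁.left_mem, h⟩]; exact pPQ.2
      · rw [show x = q from hA₂₃ ⟨h, hA₃.right_mem⟩]; exact qPQ.2
    · exact B₃Q h
  · rintro x ⟨hx, hx'⟩ hxV
    have hxPQ := hinter ⟨hx, hx'⟩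
    have hxp : x ≠ p := by rintro rfl; exact hpP' hxV hx
    have hxq : x ≠ q := by rintro rfl; exact hqP' hxV hx
    -- A common point other than `p` and `q` lies on neither exchanged segment, so near it `P'`
    -- still follows `P` and `Q'` follows `Q`.
    have hxB₂ : x ∉ B₂ := fun h => by
      rcases hF ⟨hxPQ.1, h⟩ with h | h
      exacts [hxp h, hxq h]
    have hxA₂ : x ∉ A₂ := fun h => by
      rcases hP'R ⟨hx, Or.inl hxPQ.1⟩ with (h' | h') | h'
      exacts [hxp (hA₁₂ ⟨h', h⟩), hxB₂ h', hxq (hA₂₃ ⟨h, h'⟩)]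
    refine (hc x hxPQ hxV).congr (hP'.eventually_mem_iff hP hx (hend hxV).1 (hend hxV).2.1 ?_)
      (hQ'.eventually_mem_iff hQ hx' (hend hxV).2.2.1 (hend hxV).2.2.2 ?_)
    · filter_upwards [near hB₂.isClosed hxB₂, near hKcl (hKPQ x hxPQ hxp hxq)] with w h1 h2 h3
      rcases hP'sub' h3 with ((h | h) | h) | h
      exacts [A₁P h, absurd h h1, A₃P h, absurd h h2]
    · filter_upwards [near hA₂.isClosed hxA₂] with w h1 h2
      rcases hQ'sub h2 with (h | h) | h
      exacts [B₁Q h, absurd h h1, B₃Q h]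
  · intro x hx hxV hxK hxPQ
    have hw : ∀ w ∈ P', w ∉ K₁ ∪ K₂ → w ∈ P ∪ Q := fun w h1 h2 =>
      hR ((hP'sub' h1).resolve_right h2)
    rcases hw x hx hxK with h | h
    · refine Or.inl ⟨h, hP'.eventually_mem_iff hP hx (hend hxV).1 (hend hxV).2.1 ?_⟩
      filter_upwards [near hKcl hxK, near hQcl fun h' => hxPQ ⟨h, h'⟩] with w h1 h2 h3
      exact (hw w h3 h1).resolve_right h2
    · refine Or.inr ⟨h, hP'.eventually_mem_iff hQ hx (hend hxV).1 (hend hxV).2.1 ?_⟩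
      filter_upwards [near hKcl hxK, near hPcl fun h' => hxPQ ⟨h', h⟩] with w h1 h2 h3
      exact (hw w h3 h1).resolve_left h2
  · intro x hx hxV hxPQ
    have hw : Q' ⊆ P ∪ Q := hQ'sub.trans hR'
    rcases hw hx with h | h
    · refine Or.inl ⟨h, hQ'.eventually_mem_iff hP hx (hend hxV).2.2.1 (hend hxV).2.2.2 ?_⟩
      filter_upwards [near hQcl fun h' => hxPQ ⟨h, h'⟩] with w h2 h3
      exact (hw h3).resolve_right h2
    · refine Or.inr ⟨h, hQ'.eventually_mem_iff hQ hx (hend hxV).2.2.1 (hend hxV).2.2.2 ?_⟩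
      filter_upwards [near hPcl fun h' => hxPQ ⟨h', h⟩] with w h2 h3
      exact (hw h3).resolve_left h2
  -- At most one of `p` and `q` is a vertex; `P'` avoids the other.
  · by_cases hpV : p ∈ V
    · have hqV : q ∉ V := fun hqV => hpq (hsub ⟨hpV, pPQ⟩ ⟨hqV, qPQ⟩)
      exact ⟨q, qPQ, hqV, fun h => hqP' hqV h.1⟩
    · exact ⟨p, pPQ, hpV, fun h => hpP' hpV h.1⟩

/-- Two arcs with at least two common points can be replaced by arcs with the same ends that have
fewer common points. -/
theorem exists_isSwap {u v u' v' : Plane} {P Q O V : Set Plane}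
    (hP : IsArcBetween u v P) (hQ : IsArcBetween u' v' Q) (hfin : (P ∩ Q).Finite)
    (hnt : (P ∩ Q).Nontrivial)
    (hu : u ∈ V) (hv : v ∈ V) (hu' : u' ∈ V) (hv' : v' ∈ V) (hVP : V ∩ P ⊆ {u, v})
    (hVQ : V ∩ Q ⊆ {u', v'}) (hc : ∀ x ∈ P ∩ Q, x ∉ V → CrossesAt P Q x)
    (hsub : (V ∩ (P ∩ Q)).Subsingleton) (hO : ∀ x ∈ P ∩ Q, x ∉ V → O ∈ 𝓝 x) (hOV : Disjoint O V) :
    ∃ P' Q' K, IsArcBetween u v P' ∧ IsArcBetween u' v' Q' ∧ K ⊆ O ∧ IsSwap V P Q K P' Q' := by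
  obtain ⟨p, hp, q, hq, hpq, B₁, B₂, B₃, hB₁, hB₂, hB₃, hB, hB₁₂, hB₂₃, -, hF⟩ :=
    hQ.exists_consecutive hfin inter_subset_right hnt
  have hF' : P ∩ B₂ ⊆ {p, q} := fun w hw =>
    hF ⟨⟨hw.1, hB ▸ Or.inl (Or.inr hw.2)⟩, hw.2⟩
  obtain ⟨x, y, hxy, A₁, A₂, A₃, hA₁, hA₂, hA₃, hA, hA₁₂, hA₂₃, hA₁₃⟩ :=
    hP.exists_three hp.1 hq.1 hpq
  rcases hxy with ⟨rfl, rfl⟩ | ⟨rfl, rfl⟩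
  · exact exists_isSwap_of_three hA₁ hA₂ hA₃ hB₁ hB₂ hB₃ hpq hA₁₂ hA₂₃ hA₁₃ hB₁₂ hB₂₃ hP hQ hA hB
      hF' hfin hu hv hu' hv' hVP hVQ hc hsub hO hOV
  · obtain ⟨P', Q', K, h1, h2⟩ := exists_isSwap_of_three hA₁ hA₂ hA₃ hB₁ hB₂ hB₃ hpq hA₁₂ hA₂₃
      hA₁₃ hB₁₂ hB₂₃ hP hQ hA hB hF' hfin hv hu hu' hv' (by rwa [Set.pair_comm]) hVQ hc hsub hO hOV
    exact ⟨P', Q', K, h1.symm, h2⟩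

end IsArcBetween

/-! ### Optimal drawings are good. -/

namespace Drawing

open Set Filter Topology

section

variable {W : Type*} {H : SimpleGraph W}

theorem isArcBetween (D : Drawing H) {u v : W} (h : H.Adj u v) :
    IsArcBetween (D.point u) (D.point v) (D.arc s(u, v)) := by
  obtain ⟨γ, hγ, hr⟩ := D.isArc u v h
  exact hr ▸ IsArcBetween.of_path hγ

theorem isClosed_arc (D : Drawing H) {e : Sym2 W} (h : e ∈ H.edgeSet) : IsClosed (D.arc e) := by
  induction e with | _ u v => exact (D.isArcBetween h).isClosed

theorem point_mem_arc (D : Drawing H) {e : Sym2 W} (h : e ∈ H.edgeSet) {w : W} (hw : w ∈ e) :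
    D.point w ∈ D.arc e := by
  induction e with | _ u v =>
    rcases Sym2.mem_iff.1 hw with rfl | rfl
    exacts [(D.isArcBetween h).left_mem, (D.isArcBetween h).right_mem]

/-- The points of the plane at which two edges cross. -/
def crossingPoints (D : Drawing H) : Set Plane :=
  {x | x ∉ range D.point ∧ ∃ e ∈ H.edgeSet, ∃ f ∈ H.edgeSet, e ≠ f ∧ x ∈ D.arc e ∩ D.arc f}

/-- As no three edges meet outside the vertices, a crossing is determined by its point. Crossings
can therefore be counted as points of the plane, which makes drawings with different arcs
comparable. -/
theorem pair_eq (D : Drawing H) {x : Plane} (hx : x ∉ range D.point) {e f e' f' : Sym2 W}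
    (he : e ∈ H.edgeSet) (hf : f ∈ H.edgeSet) (he' : e' ∈ H.edgeSet) (hf' : f' ∈ H.edgeSet)
    (hef : e ≠ f) (hef' : e' ≠ f') (h : x ∈ D.arc e ∩ D.arc f) (h' : x ∈ D.arc e' ∩ D.arc f') :
    s(e, f) = s(e', f') := by
  have key : ∀ g ∈ H.edgeSet, x ∈ D.arc g → g = e ∨ g = f := by
    intro g hg hxg
    by_contra! hne
    exact hx (D.no_three e he f hf g hg hef hne.2.symm hne.1.symm ⟨h, hxg⟩)
  rcases key e' he' h'.1 with rfl | rfl <;> rcases key f' hf' h'.2 with rfl | rfl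
  · exact absurd rfl hef'
  · rfl
  · exact Sym2.eq_swap
  · exact absurd rfl hef'

theorem injOn_snd_crossings (D : Drawing H) : InjOn Prod.snd D.crossings := by
  rintro ⟨c, x⟩ ⟨e, he, f, hf, hef, rfl, hx, hxV⟩ ⟨c', x'⟩ ⟨e', he', f', hf', hef', rfl, hx', -⟩ h
  obtain rfl : x = x' := h
  rw [Prod.mk.injEq]
  exact ⟨D.pair_eq hxV he hf he' hf' hef hef' hx hx', rfl⟩

theorem crossingCountIn_eq (D : Drawing H) (B : Set (Sym2 (Sym2 W))) :
    D.crossingCountIn B = (Prod.snd '' {c ∈ D.crossings | c.1 ∈ B}).encard :=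
  ((D.injOn_snd_crossings.mono (sep_subset _ _)).encard_image).symm

theorem image_snd_crossings (D : Drawing H) : Prod.snd '' D.crossings = D.crossingPoints := by
  ext x; constructor
  · rintro ⟨⟨c, x⟩, ⟨e, he, f, hf, hef, rfl, hx, hxV⟩, rfl⟩
    exact ⟨hxV, e, he, f, hf, hef, hx⟩
  · rintro ⟨hxV, e, he, f, hf, hef, hx⟩
    exact ⟨(s(e, f), x), ⟨e, he, f, hf, hef, rfl, hx, hxV⟩, rfl⟩

theorem crossingCount_eq (D : Drawing H) : D.crossingCount = D.crossingPoints.encard := by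
  rw [crossingCount, ← D.image_snd_crossings, D.injOn_snd_crossings.encard_image]

theorem _root_.eq_and_eq_or_of_mem_pair {α : Type*} {e f g k : α} (hgk : g ≠ k)
    (hg : ¬(g ≠ e ∧ g ≠ f)) (hk : ¬(k ≠ e ∧ k ≠ f)) : g = e ∧ k = f ∨ g = f ∧ k = e := by
  grind

/-- Interchanging segments of the arcs of two edges of a drawing. -/
theorem exists_crossingPoints_ssubset_of_isSwap (D : Drawing H) {u v u' v' : W} {e f : Sym2 W}
    (he : e = s(u, v)) (hf : f = s(u', v')) (heE : e ∈ H.edgeSet) (hfE : f ∈ H.edgeSet)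
    (hef : e ≠ f) {K P' Q' : Set Plane}
    (hP' : IsArcBetween (D.point u) (D.point v) P')
    (hQ' : IsArcBetween (D.point u') (D.point v') Q')
    (h : IsArcBetween.IsSwap (range D.point) (D.arc e) (D.arc f) K P' Q')
    (hK : ∀ g ∈ H.edgeSet, g ≠ e → g ≠ f → Disjoint K (D.arc g)) :
    ∃ D' : Drawing H, D'.crossingPoints ⊂ D.crossingPoints := by
  obtain ⟨A, Ae, Af, Ag⟩ : ∃ A : Sym2 W → Set Plane, A e = P' ∧ A f = Q' ∧
      ∀ g, g ≠ e → g ≠ f → A g = D.arc g := by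
    classical
    refine ⟨fun g => if g = e then P' else if g = f then Q' else D.arc g, by simp, ?_, ?_⟩
    · simp [hef.symm]
    · intro g h1 h2; simp [h1, h2]
  -- Where a new arc meets an unchanged edge `k` outside the vertices, it follows a single old edge
  -- `g₀` locally: a third edge `k` excludes common points of `e` and `f`, and `K` avoids `k`. So
  -- crossings with `k` are inherited from `g₀`.
  have key : ∀ g ∈ H.edgeSet, ∀ k ∈ H.edgeSet, g ≠ k → k ≠ e → k ≠ f → ∀ x ∈ A g, x ∈ D.arc k →
      x ∉ range D.point → ∃ g₀ ∈ H.edgeSet, x ∈ D.arc g₀ ∧ (∀ᶠ w in 𝓝 x, w ∈ A g ↔ w ∈ D.arc g₀) ∧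
        (g ≠ e ∧ g ≠ f ∧ g₀ = g ∨ (g = e ∨ g = f) ∧ (g₀ = e ∨ g₀ = f)) := by
    intro g hg k hk hgk hke hkf x hxg hxk hxV
    have hxef : x ∉ D.arc e ∩ D.arc f := fun hx =>
      hxV (D.no_three e heE f hfE k hk hef hkf.symm hke.symm ⟨hx, hxk⟩)
    by_cases hge : g = e
    · subst hge
      rw [Ae] at hxg ⊢
      rcases h.germ_left x hxg hxV (disjoint_right.1 (hK k hk hke hkf) hxk) hxef with h' | h'
      exacts [⟨g, hg, h'.1, h'.2, Or.inr ⟨Or.inl rfl, Or.inl rfl⟩⟩,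
        ⟨f, hfE, h'.1, h'.2, Or.inr ⟨Or.inl rfl, Or.inr rfl⟩⟩]
    by_cases hgf : g = f
    · subst hgf
      rw [Af] at hxg ⊢
      rcases h.germ_right x hxg hxV hxef with h' | h'
      exacts [⟨e, heE, h'.1, h'.2, Or.inr ⟨Or.inr rfl, Or.inl rfl⟩⟩,
        ⟨g, hg, h'.1, h'.2, Or.inr ⟨Or.inr rfl, Or.inr rfl⟩⟩]
    rw [Ag g hge hgf] at hxg ⊢
    exact ⟨g, hg, hxg, Eventually.of_forall fun _ => Iff.rfl, Or.inl ⟨hge, hgf, rfl⟩⟩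
  have key_ne : ∀ {g k g₀ : Sym2 W}, g ≠ k → k ≠ e → k ≠ f →
      (g ≠ e ∧ g ≠ f ∧ g₀ = g ∨ (g = e ∨ g = f) ∧ (g₀ = e ∨ g₀ = f)) → g₀ ≠ k := by
    grind
  have cross : ∀ g ∈ H.edgeSet, ∀ k ∈ H.edgeSet, g ≠ k → k ≠ e → k ≠ f → ∀ x ∈ A g, x ∈ A k →
      x ∉ range D.point → CrossesAt (A g) (A k) x := by
    intro g hg k hk hgk hke hkf x hxg hxk hxV
    rw [Ag k hke hkf] at hxk ⊢
    obtain ⟨g₀, hg₀, hx₀, hgerm, hor⟩ := key g hg k hk hgk hke hkf x hxg hxk hxV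
    exact (D.crossesAt g₀ hg₀ k hk (key_ne hgk hke hkf hor) x ⟨hx₀, hxk⟩ hxV).congr hgerm
      (Eventually.of_forall fun _ => Iff.rfl)
  have three : ∀ g₁ ∈ H.edgeSet, ∀ g₂ ∈ H.edgeSet, ∀ g₃ ∈ H.edgeSet, g₁ ≠ g₂ → g₂ ≠ g₃ → g₁ ≠ g₃ →
      g₃ ≠ e → g₃ ≠ f → ∀ x ∈ A g₁, x ∈ A g₂ → x ∈ A g₃ → x ∈ range D.point := by
    intro g₁ h₁ g₂ h₂ g₃ h₃ h₁₂ h₂₃ h₁₃ h3e h3f x hx₁ hx₂ hx₃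
    by_contra hxV
    rw [Ag g₃ h3e h3f] at hx₃
    by_cases hh : g₂ ≠ e ∧ g₂ ≠ f
    · rw [Ag g₂ hh.1 hh.2] at hx₂
      obtain ⟨g₀, hg₀, hx₀, -, hor⟩ := key g₁ h₁ g₃ h₃ h₁₃ h3e h3f x hx₁ hx₃ hxV
      exact hxV (D.no_three g₀ hg₀ g₂ h₂ g₃ h₃ (key_ne h₁₂ hh.1 hh.2 hor) h₂₃
        (key_ne h₁₃ h3e h3f hor) ⟨⟨hx₀, hx₂⟩, hx₃⟩)
    by_cases hh' : g₁ ≠ e ∧ g₁ ≠ f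
    · rw [Ag g₁ hh'.1 hh'.2] at hx₁
      obtain ⟨g₀, hg₀, hx₀, -, hor⟩ := key g₂ h₂ g₃ h₃ h₂₃ h3e h3f x hx₂ hx₃ hxV
      exact hxV (D.no_three g₀ hg₀ g₁ h₁ g₃ h₃ (key_ne h₁₂.symm hh'.1 hh'.2 hor) h₁₃
        (key_ne h₂₃ h3e h3f hor) ⟨⟨hx₀, hx₁⟩, hx₃⟩)
    have hx : x ∈ A e ∩ A f := by
      rcases eq_and_eq_or_of_mem_pair h₁₂ hh' hh with ⟨rfl, rfl⟩ | ⟨rfl, rfl⟩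
      exacts [⟨hx₁, hx₂⟩, ⟨hx₂, hx₁⟩]
    rw [Ae, Af] at hx
    exact hxV (D.no_three e heE f hfE g₃ h₃ hef h3f.symm h3e.symm ⟨h.inter_subset hx, hx₃⟩)
  let D' : Drawing H :=
    { point := D.point
      arc := A
      point_injective := D.point_injective
      isArc := by
        intro a b hab
        have hne : D.point a ≠ D.point b := fun h => hab.ne (D.point_injective h)
        have harc : IsArcBetween (D.point a) (D.point b) (A s(a, b)) := by
          by_cases h1 : s(a, b) = e
          · rw [h1, Ae]
            rw [he, Sym2.eq_iff] at h1
            rcases h1 with ⟨rfl, rfl⟩ | ⟨rfl, rfl⟩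
            exacts [hP', hP'.symm]
          by_cases h2 : s(a, b) = f
          · rw [h2, Af]
            rw [hf, Sym2.eq_iff] at h2
            rcases h2 with ⟨rfl, rfl⟩ | ⟨rfl, rfl⟩
            exacts [hQ', hQ'.symm]
          rw [Ag _ h1 h2]
          exact D.isArcBetween hab
        exact harc.exists_path hne
      mem_of_point_mem := by
        intro g hg w hw
        apply D.mem_of_point_mem g hg w
        by_cases h1 : g = e
        · rw [h1] at hw ⊢
          exact h.vertex_left ⟨⟨w, rfl⟩, Ae ▸ hw⟩
        by_cases h2 : g = f
        · rw [h2] at hw ⊢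
          exact h.vertex_right ⟨⟨w, rfl⟩, Af ▸ hw⟩
        rwa [Ag _ h1 h2] at hw
      crossesAt := by
        rintro g hg k hk hgk x ⟨hxg, hxk⟩ hxV
        by_cases hh : k ≠ e ∧ k ≠ f
        · exact cross g hg k hk hgk hh.1 hh.2 x hxg hxk hxV
        by_cases hh' : g ≠ e ∧ g ≠ f
        · exact (cross k hk g hg hgk.symm hh'.1 hh'.2 x hxk hxg hxV).symm
        rcases eq_and_eq_or_of_mem_pair hgk hh' hh with ⟨rfl, rfl⟩ | ⟨rfl, rfl⟩
        · rw [Ae] at hxg ⊢; rw [Af] at hxk ⊢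
          exact h.crossesAt x ⟨hxg, hxk⟩ hxV
        · rw [Af] at hxg ⊢; rw [Ae] at hxk ⊢
          exact (h.crossesAt x ⟨hxk, hxg⟩ hxV).symm
      no_three := by
        rintro g₁ h₁ g₂ h₂ g₃ h₃ h₁₂ h₂₃ h₁₃ x ⟨⟨hx₁, hx₂⟩, hx₃⟩
        by_cases hh : g₃ ≠ e ∧ g₃ ≠ f
        · exact three g₁ h₁ g₂ h₂ g₃ h₃ h₁₂ h₂₃ h₁₃ hh.1 hh.2 x hx₁ hx₂ hx₃
        by_cases hh' : g₂ ≠ e ∧ g₂ ≠ f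
        · exact three g₁ h₁ g₃ h₃ g₂ h₂ h₁₃ h₂₃.symm h₁₂ hh'.1 hh'.2 x hx₁ hx₃ hx₂
        have h1 : g₁ ≠ e ∧ g₁ ≠ f := by
          rcases eq_and_eq_or_of_mem_pair h₂₃ hh' hh with ⟨rfl, rfl⟩ | ⟨rfl, rfl⟩
          exacts [⟨h₁₂, h₁₃⟩, ⟨h₁₃, h₁₂⟩]
        exact three g₂ h₂ g₃ h₃ g₁ h₁ h₂₃ h₁₃.symm h₁₂.symm h1.1 h1.2 x hx₂ hx₃ hx₁ }
  refine ⟨D', ?_⟩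
  -- The first alternative on the right concerns the pair of `e` and `f`, the second all other
  -- pairs. Neither allows the removed point.
  have sub : ∀ g ∈ H.edgeSet, ∀ k ∈ H.edgeSet, g ≠ k → ∀ x ∈ A g, x ∈ A k →
      x ∉ range D.point → x ∈ P' ∩ Q' ∨ x ∉ D.arc e ∩ D.arc f ∧ x ∈ D.crossingPoints := by
    intro g hg k hk hgk x hxg hxk hxV
    wlog hh : k ≠ e ∧ k ≠ f generalizing g k
    · by_cases hh' : g ≠ e ∧ g ≠ f
      · exact this k hk g hg hgk.symm hxk hxg hh'
      · left
        rw [← Ae, ← Af]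
        rcases eq_and_eq_or_of_mem_pair hgk hh' hh with ⟨rfl, rfl⟩ | ⟨rfl, rfl⟩
        exacts [⟨hxg, hxk⟩, ⟨hxk, hxg⟩]
    right
    rw [Ag k hh.1 hh.2] at hxk
    obtain ⟨g₀, hg₀, hx₀, -, hor⟩ := key g hg k hk hgk hh.1 hh.2 x hxg hxk hxV
    exact ⟨fun hx => hxV (D.no_three e heE f hfE k hk hef hh.2.symm hh.1.symm ⟨hx, hxk⟩),
      hxV, g₀, hg₀, k, hk, key_ne hgk hh.1 hh.2 hor, hx₀, hxk⟩
  obtain ⟨x₀, hx₀, hx₀V, hx₀'⟩ := h.exists_removed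
  refine (ssubset_iff_of_subset ?_).2 ⟨x₀, ⟨hx₀V, e, heE, f, hfE, hef, hx₀⟩, ?_⟩
  · rintro x ⟨hxV, g, hg, k, hk, hgk, hxg, hxk⟩
    rcases sub g hg k hk hgk x hxg hxk hxV with h' | h'
    · exact ⟨hxV, e, heE, f, hfE, hef, h.inter_subset h'⟩
    · exact h'.2
  · rintro ⟨hxV, g, hg, k, hk, hgk, hxg, hxk⟩
    rcases sub g hg k hk hgk x₀ hxg hxk hxV with h' | h'
    exacts [hx₀' h', h'.1 hx₀]

/-- Two distinct common vertices would be the ends of both edges, and these would coincide. -/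
theorem vertex_inter_subsingleton (D : Drawing H) {e f : Sym2 W} (he : e ∈ H.edgeSet)
    (hf : f ∈ H.edgeSet) (hef : e ≠ f) :
    (range D.point ∩ (D.arc e ∩ D.arc f)).Subsingleton := by
  rintro _ ⟨⟨w, rfl⟩, hwe, hwf⟩ _ ⟨⟨w', rfl⟩, hwe', hwf'⟩
  by_contra hne
  have hww : w ≠ w' := fun h => hne (by rw [h])
  exact hef (((Sym2.mem_and_mem_iff hww).1 ⟨D.mem_of_point_mem e he w hwe,
    D.mem_of_point_mem e he w' hwe'⟩).trans ((Sym2.mem_and_mem_iff hww).1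
      ⟨D.mem_of_point_mem f hf w hwf, D.mem_of_point_mem f hf w' hwf'⟩).symm)

/-- If two edges of a drawing with finitely many crossings have two common points, then there is a
drawing with fewer crossings. -/
theorem exists_crossingPoints_ssubset [Finite W] (D : Drawing H) (hfin : D.crossingPoints.Finite)
    {e f : Sym2 W} (he : e ∈ H.edgeSet) (hf : f ∈ H.edgeSet) (hef : e ≠ f)
    (hnt : (D.arc e ∩ D.arc f).Nontrivial) :
    ∃ D' : Drawing H, D'.crossingPoints ⊂ D.crossingPoints := by
  obtain ⟨u, v, rfl⟩ : ∃ u v, e = s(u, v) := by induction e with | _ u v => exact ⟨u, v, rfl⟩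
  obtain ⟨u', v', rfl⟩ : ∃ u v, f = s(u, v) := by induction f with | _ u v => exact ⟨u, v, rfl⟩
  have hVfin : (range D.point).Finite := finite_range _
  have hends : ∀ {a b : W}, s(a, b) ∈ H.edgeSet →
      range D.point ∩ D.arc s(a, b) ⊆ {D.point a, D.point b} := by
    rintro a b hab _ ⟨⟨w, rfl⟩, hw⟩
    rcases Sym2.mem_iff.1 (D.mem_of_point_mem _ hab w hw) with rfl | rfl
    exacts [Or.inl rfl, Or.inr rfl]
  have hefin : (D.arc s(u, v) ∩ D.arc s(u', v')).Finite := by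
    refine (hfin.union hVfin).subset fun x hx => ?_
    by_cases hxV : x ∈ range D.point
    · exact Or.inr hxV
    · exact Or.inl ⟨hxV, _, he, _, hf, hef, hx⟩
  set R : Set (Sym2 W) := {g ∈ H.edgeSet | g ≠ s(u, v) ∧ g ≠ s(u', v')} with hR
  -- The corners are cut inside this open set, clear of all vertices and all other edges.
  set O : Set Plane := (range D.point ∪ ⋃ g ∈ R, D.arc g)ᶜ with hO
  have hOopen : IsOpen O :=
    (hVfin.isClosed.union ((toFinite R).isClosed_biUnion fun g hg =>
      D.isClosed_arc hg.1)).isOpen_compl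
  obtain ⟨P', Q', K, hP', hQ', hKO, hswap⟩ :=
    IsArcBetween.exists_isSwap (O := O) (V := range D.point) (D.isArcBetween he)
      (D.isArcBetween hf) hefin hnt ⟨u, rfl⟩ ⟨v, rfl⟩ ⟨u', rfl⟩ ⟨v', rfl⟩ (hends he) (hends hf)
      (fun x hx hxV => D.crossesAt _ he _ hf hef x hx hxV) (D.vertex_inter_subsingleton he hf hef)
      (fun x hx hxV => hOopen.mem_nhds (by
        rintro (h | h)
        · exact hxV h
        · simp only [mem_iUnion] at h
          obtain ⟨g, hg, hxg⟩ := h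
          exact hxV (D.no_three _ he _ hf g hg.1 hef hg.2.2.symm hg.2.1.symm ⟨hx, hxg⟩)))
      (disjoint_left.2 fun x hx hxV => hx (Or.inl hxV))
  refine D.exists_crossingPoints_ssubset_of_isSwap rfl rfl he hf hef hP' hQ' hswap ?_
  intro g hg h1 h2
  exact disjoint_left.2 fun x hx hxg => hKO hx (Or.inr (mem_biUnion (x := g) ⟨hg, h1, h2⟩ hxg))

/-- A drawing with the minimum number of crossings is good, provided that this number is finite. -/
theorem isGood_of_minimal [Finite W] (D : Drawing H) (hfin : D.crossingCount ≠ ⊤)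
    (hmin : ∀ D' : Drawing H, D.crossingCount ≤ D'.crossingCount) : D.IsGood := by
  have hfin' : D.crossingPoints.Finite := by
    rwa [crossingCount_eq, encard_ne_top_iff] at hfin
  have hsub : ∀ e ∈ H.edgeSet, ∀ f ∈ H.edgeSet, e ≠ f → (D.arc e ∩ D.arc f).Subsingleton := by
    intro e he f hf hef
    by_contra hnt
    obtain ⟨D', hD'⟩ := D.exists_crossingPoints_ssubset hfin' he hf hef
      (not_subsingleton_iff.1 hnt)
    have := hmin D'
    rw [crossingCount_eq, crossingCount_eq] at this
    exact absurd this (not_le.2 ((hfin'.subset hD'.subset).encard_lt_encard hD'))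
  refine ⟨fun e he f hf hef w hwe hwf => ?_, hsub⟩
  have hw : D.point w ∈ D.arc e ∩ D.arc f := ⟨D.point_mem_arc he hwe, D.point_mem_arc hf hwf⟩
  exact (hsub e he f hf hef).eq_singleton_of_mem hw

/-- A finite crossing number is attained by a good drawing. -/
theorem _root_.exists_isGood_of_crossingNumber_ne_top [Finite W] (h : crossingNumber H ≠ ⊤) :
    ∃ D : Drawing H, D.IsGood ∧ D.crossingCount = crossingNumber H := by
  have hne : Nonempty (Drawing H) := by
    by_contra hne
    rw [not_nonempty_iff] at hne
    exact h (by rw [crossingNumber, iInf_of_empty])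
  obtain ⟨D, hD⟩ := ciInf_mem fun D : Drawing H => D.crossingCount
  have hD' : D.crossingCount = crossingNumber H := hD
  refine ⟨D, D.isGood_of_minimal (hD' ▸ h) fun D' => ?_, hD'⟩
  rw [hD']
  exact iInf_le _ D'

end

end Drawing

/-! ### Subdrawings and merging paths of two edges. -/

namespace Drawing

open Set Filter Topology

section

variable {W W' : Type*} {H : SimpleGraph W} {H' : SimpleGraph W'}

/-- The drawing of a subgraph that is part of a drawing. -/
def restrict (D : Drawing H) (φ : H' →g H) (hφ : Function.Injective φ) : Drawing H' where
  point := D.point ∘ φ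
  arc e := D.arc (e.map φ)
  point_injective := D.point_injective.comp hφ
  isArc u v h := D.isArc (φ u) (φ v) (φ.map_adj h)
  mem_of_point_mem e he w hw := by
    obtain ⟨w', hw', h⟩ := Sym2.mem_map.1 (D.mem_of_point_mem _ (φ.map_mem_edgeSet he) (φ w) hw)
    rwa [← hφ h]
  crossesAt e he f hf hef x hx hxV := by
    have hne := (Sym2.map.injective hφ).ne hef
    refine D.crossesAt _ (φ.map_mem_edgeSet he) _ (φ.map_mem_edgeSet hf) hne x hx ?_
    -- A vertex lying on an edge is one of its ends, so no vertex outside the subgraph lies on an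
    -- edge of it.
    rintro ⟨w, rfl⟩
    obtain ⟨w', -, rfl⟩ := Sym2.mem_map.1 (D.mem_of_point_mem _ (φ.map_mem_edgeSet he) w hx.1)
    exact hxV ⟨w', rfl⟩
  no_three e he f hf g hg hef hfg heg x hx := by
    have hi := Sym2.map.injective hφ
    obtain ⟨w, rfl⟩ := D.no_three _ (φ.map_mem_edgeSet he) _ (φ.map_mem_edgeSet hf) _
      (φ.map_mem_edgeSet hg) (hi.ne hef) (hi.ne hfg) (hi.ne heg) hx
    obtain ⟨w', -, rfl⟩ := Sym2.mem_map.1 (D.mem_of_point_mem _ (φ.map_mem_edgeSet he) w hx.1.1)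
    exact ⟨w', rfl⟩

theorem IsGood.restrict {D : Drawing H} (hD : D.IsGood) (φ : H' →g H)
    (hφ : Function.Injective φ) : (D.restrict φ hφ).IsGood := by
  have hi := Sym2.map.injective hφ
  refine ⟨fun e he f hf hef w hwe hwf => ?_, fun e he f hf hef => ?_⟩
  · exact hD.1 _ (φ.map_mem_edgeSet he) _ (φ.map_mem_edgeSet hf) (hi.ne hef) (φ w)
      (Sym2.mem_map.2 ⟨w, hwe, rfl⟩) (Sym2.mem_map.2 ⟨w, hwf, rfl⟩)
  · exact hD.2 _ (φ.map_mem_edgeSet he) _ (φ.map_mem_edgeSet hf) (hi.ne hef)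

theorem crossingCountIn_restrict_le (D : Drawing H) (φ : H' →g H) (hφ : Function.Injective φ)
    {B' : Set (Sym2 (Sym2 W'))} {B : Set (Sym2 (Sym2 W))}
    (hB : ∀ c ∈ B', c.map (Sym2.map φ) ∈ B) :
    (D.restrict φ hφ).crossingCountIn B' ≤ D.crossingCountIn B := by
  have hi := Sym2.map.injective hφ
  have hinj : Function.Injective (Prod.map (Sym2.map (Sym2.map φ)) (id : Plane → Plane)) :=
    (Sym2.map.injective hi).prodMap Function.injective_id
  rw [crossingCountIn, ← hinj.encard_image]
  apply encard_le_encard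
  rintro _ ⟨⟨c, x⟩, ⟨⟨e, he, f, hf, hef, rfl, hx, hxV⟩, hc⟩, rfl⟩
  refine ⟨⟨_, φ.map_mem_edgeSet he, _, φ.map_mem_edgeSet hf, hi.ne hef, rfl, hx, ?_⟩, hB _ hc⟩
  rintro ⟨w, rfl⟩
  obtain ⟨w', -, rfl⟩ := Sym2.mem_map.1 (D.mem_of_point_mem _ (φ.map_mem_edgeSet he) w hx.1)
  exact hxV ⟨w', rfl⟩

/-- A good drawing of a graph yields a drawing of a topological minor in which each edge stands for
one edge or for a path of two edges. -/
theorem IsGood.exists_contract {D : Drawing H} (hD : D.IsGood) {φ : W' → W}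
    (hφ : Function.Injective φ) (S : Sym2 W' → Set (Sym2 W))
    (hS : ∀ u v, H'.Adj u v → S s(u, v) = {s(φ u, φ v)} ∧ H.Adj (φ u) (φ v) ∨
      ∃ w ∉ range φ, S s(u, v) = {s(φ u, w), s(w, φ v)} ∧ H.Adj (φ u) w ∧ H.Adj w (φ v))
    (hdisj : ∀ e ∈ H'.edgeSet, ∀ f ∈ H'.edgeSet, e ≠ f → Disjoint (S e) (S f))
    (hvert : ∀ e ∈ H'.edgeSet, ∀ f ∈ H'.edgeSet, e ≠ f → ∀ g ∈ S e, ∀ h ∈ S f, ∀ w, w ∈ g → w ∈ h →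
      w ∈ range φ) :
    ∃ D' : Drawing H', ∀ x ∈ D'.crossingPoints, x ∉ range D.point ∧
      ∃ e ∈ H'.edgeSet, ∃ f ∈ H'.edgeSet, ∃ g ∈ S e, ∃ h ∈ S f, g ∈ H.edgeSet ∧ h ∈ H.edgeSet ∧
        g ≠ h ∧ x ∈ D.arc g ∩ D.arc h := by
  have hSE : ∀ e ∈ H'.edgeSet, S e ⊆ H.edgeSet := by
    intro e he g hg
    induction e with | _ u v =>
      rcases hS u v he with ⟨h, h1⟩ | ⟨w, -, h, h1, h2⟩
      · rw [h] at hg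
        obtain rfl : g = _ := hg
        exact h1
      · rw [h] at hg
        rcases hg with rfl | rfl
        exacts [h1, h2]
  have hfin : ∀ e ∈ H'.edgeSet, (S e).Finite := by
    intro e he
    induction e with | _ u v =>
      rcases hS u v he with ⟨h, -⟩ | ⟨w, -, h, -⟩ <;> rw [h] <;> exact toFinite _
  have hcommon : ∀ e ∈ H'.edgeSet, ∀ g ∈ S e, ∀ g' ∈ S e, g ≠ g' → ∃ w, w ∈ g ∧ w ∈ g' := by
    intro e he g hg g' hg' hne
    induction e with | _ u v =>
      rcases hS u v he with ⟨h, -⟩ | ⟨w, -, h, -⟩ <;> rw [h] at hg hg'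
      · exact absurd (hg.trans hg'.symm) hne
      · refine ⟨w, ?_, ?_⟩
        · rcases hg with rfl | rfl <;> simp
        · rcases hg' with rfl | rfl <;> simp
  have hpt : ∀ e ∈ H'.edgeSet, ∀ g ∈ S e, ∀ w, φ w ∈ g → w ∈ e := by
    intro e he g hg w hw
    induction e with | _ u v =>
      rcases hS u v he with ⟨h, -⟩ | ⟨w', hw', h, -⟩ <;> rw [h] at hg
      · obtain rfl : g = _ := hg
        simpa [hφ.eq_iff] using hw
      · have hne : φ w ≠ w' := fun h => hw' ⟨w, h⟩
        rcases hg with rfl | rfl <;> simp [hφ.eq_iff, hne] at hw <;> simp [hw]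
  set A : Sym2 W' → Set Plane := fun e => ⋃ g ∈ S e, D.arc g with hA
  have memA : ∀ {e x}, x ∈ A e ↔ ∃ g ∈ S e, x ∈ D.arc g := by simp [hA]
  -- By goodness, the two edges of a path meet only at their common end. Away from the vertices the
  -- merged arc thus coincides locally with one edge.
  have hgerm : ∀ e ∈ H'.edgeSet, ∀ g ∈ S e, ∀ x ∈ D.arc g, x ∉ range D.point →
      ∀ᶠ w in 𝓝 x, w ∈ A e ↔ w ∈ D.arc g := by
    intro e he g hg x hx hxV
    have hcl : IsClosed (⋃ g' ∈ S e \ {g}, D.arc g') :=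
      (hfin e he).sdiff.isClosed_biUnion fun g' hg' => D.isClosed_arc (hSE e he hg'.1)
    have hx' : x ∉ ⋃ g' ∈ S e \ {g}, D.arc g' := by
      simp only [mem_iUnion, not_exists]
      intro g' hg' hxg'
      obtain ⟨w, hw, hw'⟩ := hcommon e he g hg g' hg'.1 (Ne.symm hg'.2)
      have := hD.1 g (hSE e he hg) g' (hSE e he hg'.1) (Ne.symm hg'.2) w hw hw'
      exact hxV ⟨w, (this.subset ⟨hx, hxg'⟩).symm⟩
    filter_upwards [hcl.isOpen_compl.mem_nhds hx'] with w hw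
    refine ⟨fun h => ?_, fun h => memA.2 ⟨g, hg, h⟩⟩
    obtain ⟨g', hg', hwg'⟩ := memA.1 h
    by_cases hgg : g' = g
    · exact hgg ▸ hwg'
    · exact absurd (mem_biUnion (x := g') (show g' ∈ S e \ {g} from ⟨hg', hgg⟩) hwg') hw
  -- Suppressed vertices are no longer vertices, so they must not become common points of two merged
  -- arcs.
  have hvert' : ∀ e ∈ H'.edgeSet, ∀ f ∈ H'.edgeSet, e ≠ f → ∀ g ∈ S e, ∀ h ∈ S f,
      ∀ x ∈ D.arc g, x ∈ D.arc h → x ∉ range (D.point ∘ φ) → x ∉ range D.point := by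
    rintro e he f hf hef g hg h hh x hxg hxh hxV ⟨w, rfl⟩
    obtain ⟨w', rfl⟩ := hvert e he f hf hef g hg h hh w
      (D.mem_of_point_mem _ (hSE e he hg) w hxg) (D.mem_of_point_mem _ (hSE f hf hh) w hxh)
    exact hxV ⟨w', rfl⟩
  have hne : ∀ e ∈ H'.edgeSet, ∀ f ∈ H'.edgeSet, e ≠ f → ∀ g ∈ S e, ∀ h ∈ S f, g ≠ h := by
    rintro e he f hf hef g hg h hh rfl
    exact disjoint_left.1 (hdisj e he f hf hef) hg hh
  refine ⟨
    { point := D.point ∘ φ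
      arc := A
      point_injective := D.point_injective.comp hφ
      isArc := ?_
      mem_of_point_mem := ?_
      crossesAt := ?_
      no_three := ?_ }, ?_⟩
  · intro u v huv
    have hpne : D.point (φ u) ≠ D.point (φ v) :=
      fun h => huv.ne (hφ (D.point_injective h))
    refine IsArcBetween.exists_path ?_ hpne
    rcases hS u v huv with ⟨h, h1⟩ | ⟨w, -, h, h1, h2⟩
    · simpa [hA, h] using D.isArcBetween h1
    · have hgg : s(φ u, w) ≠ s(w, φ v) := by
        intro h
        rw [Sym2.eq_iff] at h
        rcases h with ⟨h, -⟩ | ⟨h, -⟩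
        exacts [h1.ne h, huv.ne (hφ h)]
      have := (D.isArcBetween h1).concat (D.isArcBetween h2)
        (hD.1 _ h1 _ h2 hgg w (by simp) (by simp)).subset
      simpa [hA, h] using this
  · intro e he w hw
    obtain ⟨g, hg, hwg⟩ := memA.1 hw
    exact hpt e he g hg w (D.mem_of_point_mem g (hSE e he hg) _ hwg)
  · rintro e he f hf hef x ⟨hxe, hxf⟩ hxV
    obtain ⟨g, hg, hxg⟩ := memA.1 hxe
    obtain ⟨h, hh, hxh⟩ := memA.1 hxf
    have hxV' := hvert' e he f hf hef g hg h hh x hxg hxh hxV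
    exact (D.crossesAt g (hSE e he hg) h (hSE f hf hh) (hne e he f hf hef g hg h hh) x ⟨hxg, hxh⟩
      hxV').congr (hgerm e he g hg x hxg hxV') (hgerm f hf h hh x hxh hxV')
  · rintro e he f hf k hk hef hfk hek x ⟨⟨hxe, hxf⟩, hxk⟩
    by_contra hxV
    obtain ⟨g, hg, hxg⟩ := memA.1 hxe
    obtain ⟨h, hh, hxh⟩ := memA.1 hxf
    obtain ⟨l, hl, hxl⟩ := memA.1 hxk
    exact hvert' e he f hf hef g hg h hh x hxg hxh hxV (D.no_three g (hSE e he hg) h (hSE f hf hh) l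
      (hSE k hk hl) (hne e he f hf hef g hg h hh) (hne f hf k hk hfk h hh l hl)
      (hne e he k hk hek g hg l hl) ⟨⟨hxg, hxh⟩, hxl⟩)
  · rintro x ⟨hxV, e, he, f, hf, hef, hxe, hxf⟩
    obtain ⟨g, hg, hxg⟩ := memA.1 hxe
    obtain ⟨h, hh, hxh⟩ := memA.1 hxf
    exact ⟨hvert' e he f hf hef g hg h hh x hxg hxh hxV, e, he, f, hf, g, hg, h, hh, hSE e he hg,
      hSE f hf hh, hne e he f hf hef g hg h hh, hxg, hxh⟩

end

/-! ### Deleting a copy of `G` from a drawing. -/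

section

variable {V : Type*} {G : SimpleGraph V}

theorem _root_.pathProduct_adj {n : ℕ} {x y : V × Fin (n + 1)} :
    (pathProduct G n).Adj x y ↔ G.Adj x.1 y.1 ∧ x.2 = y.2 ∨
      x.1 = y.1 ∧ ((x.2 : ℕ) + 1 = y.2 ∨ (y.2 : ℕ) + 1 = x.2) := by
  rw [pathProduct, SimpleGraph.boxProd_adj, SimpleGraph.pathGraph_adj]
  tauto

/-- The edges of `G □ P_(n+1)` that make up an edge of `G □ P_n` when the copy `G^i` is deleted and
the path edges at its vertices are merged. -/
def _root_.mergedEdges (G : SimpleGraph V) (n : ℕ) (i : Fin (n + 2)) (e : Sym2 (V × Fin (n + 1))) :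
    Set (Sym2 (V × Fin (n + 2))) :=
  {g | g = e.map (Prod.map id i.succAbove) ∧ g ∈ (pathProduct G (n + 1)).edgeSet ∨
    e.map (Prod.map id i.succAbove) ∉ (pathProduct G (n + 1)).edgeSet ∧
      ∃ a ∈ e, g = s(Prod.map id i.succAbove a, (a.1, i))}

/-- Skipping the index `i` breaks only the path edges that come to join `i - 1` to `i + 1`. There
are none when `i` is the first or the last index, so nothing is merged then. -/
theorem _root_.exists_eq_of_map_succAbove_not_mem {n : ℕ} {i : Fin (n + 2)}
    {e : Sym2 (V × Fin (n + 1))} (he : e ∈ (pathProduct G n).edgeSet)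
    (he' : e.map (Prod.map id i.succAbove) ∉ (pathProduct G (n + 1)).edgeSet) :
    ∃ u, ∃ j k : Fin (n + 1), (j : ℕ) + 1 = i ∧ (k : ℕ) = i ∧ e = s((u, j), (u, k)) := by
  induction e with | _ x y =>
    obtain ⟨u, j⟩ := x
    obtain ⟨v, k⟩ := y
    rw [SimpleGraph.mem_edgeSet, pathProduct_adj] at he
    rw [Sym2.map_mk, SimpleGraph.mem_edgeSet, pathProduct_adj] at he'
    simp only [Prod.map_apply, id] at he he'
    rcases he with ⟨h1, rfl⟩ | ⟨rfl, h | h⟩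
    · exact absurd (Or.inl ⟨h1, rfl⟩) he'
    · refine ⟨u, j, k, ?_, ?_, rfl⟩ <;>
      · by_contra hne
        refine he' (Or.inr ⟨rfl, ?_⟩)
        simp only [Fin.succAbove, Fin.lt_def]
        split_ifs <;> simp_all <;> omega
    · refine ⟨u, k, j, ?_, ?_, Sym2.eq_swap⟩ <;>
      · by_contra hne
        refine he' (Or.inr ⟨rfl, ?_⟩)
        simp only [Fin.succAbove, Fin.lt_def]
        split_ifs <;> simp_all <;> omega

/-- No edge of the copy is used by the new drawing. Its crossings are thus crossings of the old one,
distinct from those that involve the copy. -/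
theorem IsGood.exists_delete_copy {n : ℕ} {D : Drawing (pathProduct G (n + 1))} (hD : D.IsGood)
    (i : Fin (n + 2)) : ∃ D' : Drawing (pathProduct G n),
      D.crossingCountIn (crossPairs (copyEdges G (n + 1) (i : ℤ)) (pathProduct G (n + 1)).edgeSet) +
        D'.crossingCount ≤ D.crossingCount := by
  have hφ : Function.Injective (Prod.map id i.succAbove : V × Fin (n + 1) → V × Fin (n + 2)) :=
    Function.injective_id.prodMap Fin.succAbove_right_injective
  have hi : ∀ a : V × Fin (n + 1), (Prod.map id i.succAbove a).2 ≠ i := fun a =>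
    Fin.succAbove_ne i a.2
  -- At most one merged edge passes through each vertex of the deleted copy.
  have hdet : ∀ e ∈ (pathProduct G n).edgeSet, ∀ f ∈ (pathProduct G n).edgeSet,
      e.map (Prod.map id i.succAbove) ∉ (pathProduct G (n + 1)).edgeSet →
      f.map (Prod.map id i.succAbove) ∉ (pathProduct G (n + 1)).edgeSet →
      ∀ a ∈ e, ∀ b ∈ f, a.1 = b.1 → e = f := by
    intro e he f hf he' hf' a ha b hb hab
    obtain ⟨u, j, k, hj, hk, rfl⟩ := exists_eq_of_map_succAbove_not_mem he he'
    obtain ⟨u', j', k', hj', hk', rfl⟩ := exists_eq_of_map_succAbove_not_mem hf hf'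
    obtain rfl : j = j' := Fin.ext (by omega)
    obtain rfl : k = k' := Fin.ext (by omega)
    have h1 : a.1 = u := by rcases Sym2.mem_iff.1 ha with rfl | rfl <;> rfl
    have h2 : b.1 = u' := by rcases Sym2.mem_iff.1 hb with rfl | rfl <;> rfl
    rw [← h1, ← h2, hab]
  have hcopy : ∀ e g, g ∈ mergedEdges G n i e → g ∉ copyEdges G (n + 1) (i : ℤ) := by
    rintro e g hg ⟨u, v, i', -, hi', rfl⟩
    obtain rfl : i' = i := Fin.ext (by exact_mod_cast hi')
    obtain ⟨a, ha⟩ : ∃ a : V × Fin (n + 1),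
        Prod.map id i'.succAbove a ∈ s((u, i'), (v, i')) := by
      rcases hg with ⟨hg, -⟩ | ⟨-, a, -, hg⟩
      · induction e with | _ x y => exact ⟨x, by rw [hg]; simp⟩
      · exact ⟨a, by rw [hg]; simp⟩
    rcases Sym2.mem_iff.1 ha with h | h <;> exact hi a (by rw [h])
  obtain ⟨D', hD'⟩ := hD.exists_contract (H' := pathProduct G n) hφ (mergedEdges G n i) (by
      intro x y hxy
      by_cases hm : (pathProduct G (n + 1)).Adj (Prod.map id i.succAbove x)
        (Prod.map id i.succAbove y)
      · left
        refine ⟨?_, hm⟩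
        ext g
        constructor
        · rintro (⟨h, -⟩ | ⟨h, -⟩)
          exacts [h, absurd hm h]
        · rintro rfl
          exact Or.inl ⟨rfl, hm⟩
      · right
        obtain ⟨u, j, k, hj, hk, hjk⟩ :=
          exists_eq_of_map_succAbove_not_mem (i := i) (e := s(x, y)) hxy hm
        have hx1 : x.1 = u ∧ y.1 = u ∧ ((x.2 : ℕ) + 1 = i ∧ (y.2 : ℕ) = i ∨
            (x.2 : ℕ) = i ∧ (y.2 : ℕ) + 1 = i) := by
          rcases Sym2.eq_iff.1 hjk with ⟨rfl, rfl⟩ | ⟨rfl, rfl⟩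
          exacts [⟨rfl, rfl, Or.inl ⟨hj, hk⟩⟩, ⟨rfl, rfl, Or.inr ⟨hk, hj⟩⟩]
        obtain ⟨x1, x2⟩ := x
        obtain ⟨y1, y2⟩ := y
        obtain ⟨rfl, rfl, hor⟩ := hx1
        refine ⟨(y1, i), ?_, ?_, ?_, ?_⟩
        · rintro ⟨a, ha⟩
          exact hi a (by rw [ha])
        · ext g
          constructor
          · rintro (⟨rfl, h⟩ | ⟨-, a, ha, rfl⟩)
            · exact absurd h hm
            · rcases Sym2.mem_iff.1 ha with rfl | rfl
              exacts [Or.inl rfl, Or.inr Sym2.eq_swap]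
          · rintro (rfl | rfl)
            exacts [Or.inr ⟨hm, _, Sym2.mem_mk_left _ _, rfl⟩,
              Or.inr ⟨hm, _, Sym2.mem_mk_right _ _, Sym2.eq_swap⟩]
        · rw [pathProduct_adj]
          refine Or.inr ⟨rfl, ?_⟩
          simp only [Prod.map_apply, Fin.succAbove, Fin.lt_def]
          split_ifs <;> simp_all <;> omega
        · rw [pathProduct_adj]
          refine Or.inr ⟨rfl, ?_⟩
          simp only [Prod.map_apply, Fin.succAbove, Fin.lt_def]
          split_ifs <;> simp_all <;> omega)
    (by
      intro e he f hf hef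
      rw [disjoint_left]
      rintro g (⟨rfl, hg⟩ | ⟨he', a, ha, rfl⟩) (⟨h, hg'⟩ | ⟨hf', b, hb, h⟩)
      · exact hef (Sym2.map.injective hφ h)
      · have : (b.1, i) ∈ e.map (Prod.map id i.succAbove) := by rw [h]; simp
        obtain ⟨c, -, hc⟩ := Sym2.mem_map.1 this
        exact hi c (by rw [hc])
      · have : (a.1, i) ∈ f.map (Prod.map id i.succAbove) := by rw [← h]; simp
        obtain ⟨c, -, hc⟩ := Sym2.mem_map.1 this
        exact hi c (by rw [hc])
      · refine hef (hdet e he f hf he' hf' a ha b hb ?_)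
        rcases Sym2.eq_iff.1 h with ⟨-, h⟩ | ⟨-, h⟩
        · exact (Prod.mk.inj h).1
        · exact absurd (congrArg Prod.snd h).symm (hi b))
    (by
      rintro e he f hf hef g (⟨rfl, hg⟩ | ⟨he', a, ha, rfl⟩) h hh w hwg hwh
      · obtain ⟨c, -, hc⟩ := Sym2.mem_map.1 hwg
        exact ⟨c, hc⟩
      rcases hh with ⟨rfl, hg⟩ | ⟨hf', b, hb, rfl⟩
      · obtain ⟨c, -, hc⟩ := Sym2.mem_map.1 hwh
        exact ⟨c, hc⟩
      rcases Sym2.mem_iff.1 hwg with rfl | rfl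
      · exact ⟨a, rfl⟩
      rcases Sym2.mem_iff.1 hwh with h | h
      · exact ⟨b, h.symm⟩
      · exact absurd (hdet e he f hf he' hf' a ha b hb (Prod.mk.inj h).1) hef)
  refine ⟨D', ?_⟩
  rw [crossingCountIn_eq, crossingCount_eq, crossingCount_eq, ← encard_union_eq]
  · apply encard_le_encard
    refine union_subset ?_ ?_
    · rw [← image_snd_crossings]
      exact image_mono (sep_subset _ _)
    · intro x hx
      obtain ⟨hxV, e, -, f, -, g, -, h, -, hg, hh, hgh, hxgh⟩ := hD' x hx
      exact ⟨hxV, g, hg, h, hh, hgh, hxgh⟩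
  · rw [disjoint_left]
    rintro _ ⟨⟨c, x⟩, ⟨⟨e, he, f, hf, hef, rfl, hxef, hxV⟩, k, hk, l, hl, hkl⟩, rfl⟩ hx
    obtain ⟨-, e', -, f', -, g, hg, h, hh, hgE, hhE, hgh, hxgh⟩ := hD' _ hx
    have := D.pair_eq hxV hgE hhE he hf hgh hef hxgh hxef
    have hk' : k ∈ s(g, h) := by
      rw [this, show s(e, f) = s(k, l) from hkl]; simp
    rcases Sym2.mem_iff.1 hk' with rfl | rfl
    exacts [hcopy _ _ hg hk, hcopy _ _ hh hk]

end

end Drawing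

/-! ### Levels of pairs of edges, and counting crossings by bands. -/

section

variable {V : Type*} {G : SimpleGraph V}

open Set

/-- The inclusion of `G □ P_d` in `G □ P_n` that maps `G^0` to `G^k`. -/
def pathProductShift (G : SimpleGraph V) {d n k : ℕ} (h : d + k ≤ n) :
    pathProduct G d →g pathProduct G n where
  toFun x := (x.1, ⟨x.2 + k, by omega⟩)
  map_rel' {x y} hxy := by
    rw [pathProduct_adj] at hxy ⊢
    rcases hxy with ⟨h1, h2⟩ | ⟨h1, h2⟩
    · exact Or.inl ⟨h1, by simp [h2]⟩
    · exact Or.inr ⟨h1, by dsimp only; omega⟩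

theorem pathProductShift_injective {d n k : ℕ} (h : d + k ≤ n) :
    Function.Injective (pathProductShift G h) := by
  rintro ⟨u, i⟩ ⟨v, j⟩ hij
  simp only [pathProductShift, RelHom.coeFn_mk, Prod.mk.injEq, Fin.mk.injEq] at hij
  exact Prod.ext hij.1 (Fin.ext (by simpa using hij.2))

/-- The sum of the indices of the copies of `G` that contain the ends of an edge of `G □ P_n`. -/
def edgeLevel {n : ℕ} (e : Sym2 (V × Fin (n + 1))) : ℤ :=
  Sym2.lift ⟨fun x y => ((x.2 : ℕ) : ℤ) + ((y.2 : ℕ) : ℤ), fun _ _ => add_comm _ _⟩ e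

/-- The sum of the levels of a pair of edges of `G □ P_n`. -/
def pairLevel {n : ℕ} (c : Sym2 (Sym2 (V × Fin (n + 1)))) : ℤ :=
  Sym2.lift ⟨fun e f => edgeLevel e + edgeLevel f, fun _ _ => add_comm _ _⟩ c

theorem pairLevel_map_shift {d n k : ℕ} (h : d + k ≤ n) (c : Sym2 (Sym2 (V × Fin (d + 1)))) :
    pairLevel (c.map (Sym2.map (pathProductShift G h))) = pairLevel c + 4 * k := by
  induction c with | _ e f =>
    induction e with | _ x y =>
      induction f with | _ z w =>
        simp only [Sym2.map_mk, pairLevel, edgeLevel, Sym2.lift_mk, pathProductShift,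
          RelHom.coeFn_mk]
        push_cast
        ring

theorem edgeLevel_of_mem_copyEdges {n : ℕ} {k : ℤ} {e : Sym2 (V × Fin (n + 1))}
    (he : e ∈ copyEdges G n k) : edgeLevel e = 2 * k := by
  obtain ⟨u, v, i, -, rfl, rfl⟩ := he
  simp only [edgeLevel, Sym2.lift_mk]
  ring

theorem edgeLevel_of_mem_linkEdges {n : ℕ} {k : ℤ} {e : Sym2 (V × Fin (n + 1))}
    (he : e ∈ linkEdges V n k) : edgeLevel e = 2 * k + 1 := by
  obtain ⟨u, i, j, hi, hj, rfl⟩ := he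
  simp only [edgeLevel, Sym2.lift_mk]
  linarith

/-- Edges of `G^k` have level `2k` and edges of `H^k` have level `2k + 1`. The resulting windows of
four levels are disjoint for distinct `i`, and a shift by one copy moves each window to the next. -/
theorem pairLevel_of_mem_crossingBand {n : ℕ} {i : ℤ} {c : Sym2 (Sym2 (V × Fin (n + 1)))}
    (hc : c ∈ crossingBand G n i) : 4 * i - 2 ≤ pairLevel c ∧ pairLevel c ≤ 4 * i + 1 := by
  rw [crossingBand, mem_iUnion₂] at hc
  obtain ⟨j, -, ⟨e, he, f, hf, rfl⟩ | ⟨e, he, f, hf, rfl⟩⟩ := hc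
  · have h1 : edgeLevel e = 2 * j ∨ edgeLevel e = 2 * j + 1 :=
      he.imp edgeLevel_of_mem_copyEdges edgeLevel_of_mem_linkEdges
    have h2 : edgeLevel f = 2 * (2 * i - j - 1) ∨ edgeLevel f = 2 * (2 * i - j - 1) + 1 ∨
        edgeLevel f = 2 * (2 * i - j) := by
      rcases hf with (hf | hf) | hf
      exacts [Or.inl (edgeLevel_of_mem_copyEdges hf),
        Or.inr (Or.inl (edgeLevel_of_mem_linkEdges hf)),
        Or.inr (Or.inr (edgeLevel_of_mem_copyEdges hf))]
    simp only [pairLevel, Sym2.lift_mk]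
    omega
  · have h1 := edgeLevel_of_mem_linkEdges he
    have h2 := edgeLevel_of_mem_linkEdges hf
    simp only [pairLevel, Sym2.lift_mk]
    omega

theorem copyEdges_map_shift {d n k : ℕ} (h : d + k ≤ n) {l : ℤ} {e : Sym2 (V × Fin (d + 1))}
    (he : e ∈ copyEdges G d l) : e.map (pathProductShift G h) ∈ copyEdges G n (l + k) := by
  obtain ⟨u, v, i, huv, rfl, rfl⟩ := he
  exact ⟨u, v, ⟨i + k, by omega⟩, huv, by push_cast; rfl, rfl⟩

namespace Drawing

theorem IsRestricted.restrict_shift {d n k a : ℕ} {D : Drawing (pathProduct G n)}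
    (hD : D.IsRestricted a) (h : d + k ≤ n) :
    (D.restrict (pathProductShift G h) (pathProductShift_injective h)).IsRestricted a := by
  refine ⟨hD.1.restrict _ _, fun i => ?_⟩
  refine (D.crossingCountIn_restrict_le _ _ ?_).trans_lt (hD.2 ⟨i + k, by omega⟩)
  rintro _ ⟨e, he, f, hf, rfl⟩
  refine ⟨_, ?_, _, (pathProductShift G h).map_mem_edgeSet hf, rfl⟩
  have := copyEdges_map_shift h he
  push_cast
  exact this

/-- The restricted crossing number of a part of `G □ P_d` bounds the crossings of a restricted
drawing of `G □ P_n` in the corresponding part of a copy of `G □ P_d`. -/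
theorem IsRestricted.restrictedCrossingNumber_le {d n k a : ℕ} {D : Drawing (pathProduct G n)}
    (hD : D.IsRestricted a) (h : d + k ≤ n) {B : Set (Sym2 (Sym2 (V × Fin (d + 1))))}
    {T : Set (Sym2 (Sym2 (V × Fin (n + 1))))}
    (hB : ∀ c ∈ B, c.map (Sym2.map (pathProductShift G h)) ∈ T) :
    restrictedCrossingNumber G a d B ≤ D.crossingCountIn T := by
  have h1 := D.crossingCountIn_restrict_le _ (pathProductShift_injective h) hB
  exact le_trans (iInf_le (fun D : {D : Drawing (pathProduct G d) // D.IsRestricted a} =>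
    D.1.crossingCountIn B) ⟨_, hD.restrict_shift h⟩) h1

theorem crossingCountIn_add_le {W : Type*} {H : SimpleGraph W} (D : Drawing H)
    {B B' T : Set (Sym2 (Sym2 W))} (hd : Disjoint B B') (hB : B ∪ B' ⊆ T) :
    D.crossingCountIn B + D.crossingCountIn B' ≤ D.crossingCountIn T := by
  rw [crossingCountIn, crossingCountIn, ← encard_union_eq]
  · apply encard_le_encard
    rintro c (hc | hc)
    exacts [⟨hc.1, hB (Or.inl hc.2)⟩, ⟨hc.1, hB (Or.inr hc.2)⟩]
  · exact disjoint_left.2 fun c hc hc' => disjoint_left.1 hd hc.2 hc'.2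

theorem crossingCountIn_le {W : Type*} {H : SimpleGraph W} (D : Drawing H)
    (B : Set (Sym2 (Sym2 W))) : D.crossingCountIn B ≤ D.crossingCount :=
  encard_le_encard (sep_subset _ _)

/-- There are `n - d + 1` translates of `G □ P_d` in `G □ P_n`. Their middle bands occupy
consecutive windows of levels, with the front bands of the first translate below and the end bands
of the last one above. -/
theorem IsRestricted.force_le {d m a n : ℕ} {D : Drawing (pathProduct G n)}
    (hD : D.IsRestricted a) (hdn : d ≤ n) (hM : (a : ℕ∞) ≤ middleForce G d m a) :
    frontForce G d m a + ((n - d + 1) * a : ℕ) + endForce G d m a ≤ D.crossingCount := by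
  -- The levels below `4(m + t) - 2` contain the front bands and the middle bands of the first `t`
  -- translates.
  have hfront : ∀ t : ℕ, t ≤ n - d + 1 → frontForce G d m a + (t * a : ℕ) ≤
      D.crossingCountIn {c | pairLevel c < 4 * ((m : ℤ) + t) - 2} := by
    intro t
    induction t with
    | zero =>
      intro _
      simp only [zero_mul, Nat.cast_zero, add_zero]
      refine hD.restrictedCrossingNumber_le (k := 0) (by omega) fun c hc => ?_
      rw [mem_iUnion₂] at hc
      obtain ⟨i, hi, hc⟩ := hc
      have := pairLevel_of_mem_crossingBand hc
      rw [mem_ofPred_eq, pairLevel_map_shift]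
      have := hi.2
      omega
    | succ t ih =>
      intro ht
      have h1 : (a : ℕ∞) ≤ D.crossingCountIn {c | 4 * ((m : ℤ) + t) - 2 ≤ pairLevel c ∧
          pairLevel c ≤ 4 * ((m : ℤ) + t) + 1} := by
        refine hM.trans (hD.restrictedCrossingNumber_le (k := t) (by omega) fun c hc => ?_)
        have := pairLevel_of_mem_crossingBand hc
        rw [mem_ofPred_eq, pairLevel_map_shift]
        omega
      rw [add_one_mul, Nat.cast_add, ← add_assoc]
      refine (add_le_add (ih (by omega)) h1).trans (D.crossingCountIn_add_le ?_ ?_)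
      · exact disjoint_left.2 fun c hc hc' => by
          have h1 := mem_ofPred_eq ▸ hc
          have h2 := hc'.1
          omega
      · rintro c (hc | ⟨-, hc⟩) <;> simp only [mem_ofPred_eq] at hc ⊢ <;> push_cast <;> omega
  have hend : endForce G d m a ≤ D.crossingCountIn
      {c | 4 * ((m : ℤ) + (n - d + 1 : ℕ)) - 2 ≤ pairLevel c} := by
    refine hD.restrictedCrossingNumber_le (k := n - d) (by omega) fun c hc => ?_
    rw [mem_iUnion₂] at hc
    obtain ⟨i, hi, hc⟩ := hc
    have := pairLevel_of_mem_crossingBand hc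
    rw [mem_ofPred_eq, pairLevel_map_shift]
    have := hi.1
    push_cast
    omega
  refine (add_le_add (hfront _ le_rfl) hend).trans
    ((D.crossingCountIn_add_le (T := univ) ?_ (subset_univ _)).trans (D.crossingCountIn_le _))
  exact disjoint_left.2 fun c hc hc' => by
    simp only [mem_ofPred_eq] at hc hc'
    omega

end Drawing

end

/-! ### The induction on the length of the path. -/

theorem mainTheorem1 {V : Type*} [Finite V] (G : SimpleGraph V) (d m a : ℕ) (b : ℤ)
    (hd : 2 ≤ d) (hm : 0 < m) (hmd : m < d) (ha : 0 < a)
    (hbase : AtLeast (crossingNumber (pathProduct G (d - 1))) (a * ((d : ℤ) - 1) - b))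
    (hFE : AtLeast (frontForce G d m a + endForce G d m a) (a * ((d : ℤ) - 1) - b))
    (hM : (a : ℕ∞) ≤ middleForce G d m a) :
    ∀ n : ℕ, d ≤ n → AtLeast (crossingNumber (pathProduct G n)) (a * (n : ℤ) - b) := by
  have hprev : AtLeast (crossingNumber (pathProduct G (d - 1))) (a * ((d - 1 : ℕ) : ℤ) - b) := by
    rwa [Nat.cast_sub (by omega), Nat.cast_one]
  suffices h : ∀ n : ℕ, d - 1 ≤ n →
      AtLeast (crossingNumber (pathProduct G n)) (a * (n : ℤ) - b) from
    fun n hn => h n (by omega)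
  intro n hn
  induction n, hn using Nat.le_induction with
  | base => exact hprev
  | succ n hn ih =>
    -- Only a finite crossing number `k` needs to be considered, and then a good optimal drawing
    -- exists.
    intro k hk
    obtain ⟨D, hgood, hD⟩ := exists_isGood_of_crossingNumber_ne_top
      (H := pathProduct G (n + 1)) (by rw [hk]; exact ENat.natCast_ne_top k)
    rw [hk] at hD
    by_cases hres : D.IsRestricted a
    · have hle := hres.force_le (d := d) (m := m) (by omega) hM
      rw [hD, add_right_comm] at hle
      obtain ⟨s, hs⟩ := ENat.ne_top_iff_exists.1
        (ne_top_of_le_ne_top (ENat.natCast_ne_top k) (le_self_add.trans hle))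
      have h1 := hFE s hs.symm
      rw [← hs] at hle
      have h2 : s + (n + 1 - d + 1) * a ≤ k := by exact_mod_cast hle
      -- With `n + 1 = d + r` there are `r + 1` translates, and `(d - 1) + (r + 1) = n + 1` is the
      -- required multiple of `a`.
      obtain ⟨r, hr⟩ : ∃ r, n + 1 = d + r := ⟨n + 1 - d, by omega⟩
      have h3 : (s : ℤ) + (r + 1) * a ≤ k := by
        rw [hr, Nat.add_sub_cancel_left] at h2
        exact_mod_cast h2
      have h4 : ((n + 1 : ℕ) : ℤ) = d + r := by exact_mod_cast hr
      rw [h4]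
      linarith
    · obtain ⟨i, hi⟩ : ∃ i : Fin (n + 1 + 1), (a : ℕ∞) ≤ D.crossingCountIn
          (crossPairs (copyEdges G (n + 1) (i : ℤ)) (pathProduct G (n + 1)).edgeSet) := by
        by_contra! h
        exact hres ⟨hgood, h⟩
      obtain ⟨D', hD'⟩ := hgood.exists_delete_copy i
      have hle : (a : ℕ∞) + crossingNumber (pathProduct G n) ≤ k := by
        rw [← hD]
        exact (add_le_add hi (iInf_le _ D')).trans hD'
      obtain ⟨s, hs⟩ := ENat.ne_top_iff_exists.1
        (ne_top_of_le_ne_top (ENat.natCast_ne_top k) (le_add_self.trans hle))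
      have h1 := ih s hs.symm
      rw [← hs] at hle
      have h2 : (a : ℤ) + s ≤ k := by exact_mod_cast hle
      push_cast
      linarith
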